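/- Let $T$ be an arbitrary set, $\mathcal F(T)$ the set of its finite subsets and $\mathcal P(T)$ its power set, with the topology generated by the maps $Q\mapsto \mathbf 1_{t\in Q}$, $t\in T$ (the Cantor cube $\{0,1\}^T$), and the Borel $\sigma$-algebra of that topology. A process $X=\{X_t\}_{t\in T}$ is simple max-stable if $\mathbb P(X_t\le x)=e^{-1/x}$ for all $t\in T$, $x>0$, and if for every $n\ge 1$ the pointwise maximum of $n$ independent copies of $X$ has the same law as $nX$. Its extremal coefficient function (ECF) is $\theta:\mathcal F(T)\to[0,\infty)$, $\theta(\varnothing)=0$, $\theta(A)=\lim_{x\to\infty}\log\mathbb P(\bigvee_{t\in A}X_t\le x)/\log\mathbb P(X_s\le x)$ for $A\neq\varnothing$ (for any $s\in T$). Theorem. Let $\theta$ be the ECF of a simple max-stable process on $T$. Then there is exactly one Radon measure $\mu$ on $\mathcal P(T)\setminus\{\varnothing\}$ (a Borel measure that is finite on compact sets and inner regular) with $$\theta(A)=\mu(\{Q : A\cap Q\neq\varnothing\})\qquad (A\in\mathcal F(T)).$$ Regard $\mu$ as a measure on $\mathcal P(T)$ that gives no mass to $\{\varnothing\}$, and put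 $V_t(Q)=\mathbf 1_{t\in Q}$. Let $X^*=\{X^*_t\}_{t\in T}$ be the Tawn--Molchanov process with ECF $\theta$, that is, the process with finite-dimensional distributions $$-\log\mathbb P(X^*_t\le x_t,\ t\in M)=\sum_{\varnothing\ne L\subset M}\tau^M_L\bigvee_{t\in L}\frac1{x_t},\qquad \tau^M_L=\sum_{I\subset L}(-1)^{|I|+1}\theta((M\setminus L)\cup I),$$ for non-empty finite $M\subset T$ and $x\in(0,\infty)^M$. Then $(\mathcal P(T),\mathcal B(\mathcal P(T)),\mu,V)$ is a spectral representation of $X^*$: each $V_t$ is measurable with $\int V_t\,d\mu=1$, a Poisson point process on $[0,\infty)\times\mathcal P(T)$ with intensity $u^{-2}\,du\times\mu(dQ)$ exists, and for every such Poisson point process $\Pi$, the law (i.e. all finite-dimensional distributions) of $X^*$ equals that of $$\Bigl\{\bigvee_{(U,Q)\in\Pi}U\,\mathbf 1_{t\in Q}\Bigr\}_{t\in T}.$$ -/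

import Mathlib

open MeasureTheory ProbabilityTheory Filter Topology
open scoped NNReal ENNReal

universe u v w z

noncomputable section

/-! ### Max-stable processes and extremal coefficient functions -/

/-- Two real- (or otherwise) valued processes indexed by `T` have the same law: all their
finite-dimensional distributions agree. -/
def SameLaw {T Ω Ω' S : Type*} [MeasurableSpace Ω] [MeasurableSpace Ω'] [MeasurableSpace S]
    (X : T → Ω → S) (P : Measure Ω) (Y : T → Ω' → S) (P' : Measure Ω') : Prop :=
  ∀ M : Finset T, IdentDistrib (fun ω (t : M) => X t ω) (fun ω (t : M) => Y t ω) P P'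

/-- A simple max-stable process: standard Fréchet marginals, and the pointwise maximum of `n`
independent copies (realised on the `n`-fold product space) has the law of `n • X`. -/
structure IsSimpleMaxStable {T Ω : Type*} [MeasurableSpace Ω] (X : T → Ω → ℝ) (P : Measure Ω)
    [IsProbabilityMeasure P] : Prop where
  measurable : ∀ t, Measurable (X t)
  frechet : ∀ t, ∀ x : ℝ, 0 < x → P {ω | X t ω ≤ x} = ENNReal.ofReal (Real.exp (-(1 / x)))
  maxStable : ∀ n : ℕ, 0 < n →
    SameLaw (fun t (ω : Fin n → Ω) => ⨆ i : Fin n, X t (ω i)) (Measure.pi fun _ : Fin n => P)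
      (fun t ω => (n : ℝ) * X t ω) P

/-- `θ` is the extremal coefficient function of the process `X`. -/
def IsECFOf {T Ω : Type*} [MeasurableSpace Ω] (θ : Finset T → ℝ) (X : T → Ω → ℝ)
    (P : Measure Ω) : Prop :=
  θ ∅ = 0 ∧ ∀ A : Finset T, A.Nonempty → ∀ s : T,
    Tendsto (fun x : ℝ => Real.log (P.real {ω | ∀ t ∈ A, X t ω ≤ x}) /
      Real.log (P.real {ω | X s ω ≤ x})) atTop (𝓝 (θ A))

/-- The set of extremal coefficient functions of simple max-stable processes on `T`. -/
def ecfSet.{r, s} (T : Type s) : Set (Finset T → ℝ) :=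
  {θ | ∃ (Ω : Type r) (_ : MeasurableSpace Ω) (P : Measure Ω) (_ : IsProbabilityMeasure P)
    (X : T → Ω → ℝ), IsSimpleMaxStable X P ∧ IsECFOf θ X P}

/-! ### The Tawn–Molchanov process -/

open Classical in
/-- The coefficient `τ^M_L = ∑_{I ⊆ L} (-1)^{|I|+1} θ((M \ L) ∪ I)`. -/
def tauCoeff {T : Type*} (θ : Finset T → ℝ) (M L : Finset T) : ℝ :=
  ∑ I ∈ L.powerset, (-1) ^ (I.card + 1) * θ ((M \ L) ∪ I)

open Classical in
/-- `X` is a Tawn–Molchanov process for `θ`: its finite-dimensional distributions are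
`-log P(X_t ≤ x_t, t ∈ M) = ∑_{∅ ≠ L ⊆ M} τ^M_L max_{t ∈ L} 1 / x_t`. -/
structure IsTMProcess {T Ω : Type*} [MeasurableSpace Ω] (θ : Finset T → ℝ) (X : T → Ω → ℝ)
    (P : Measure Ω) : Prop where
  measurable : ∀ t, Measurable (X t)
  fdd : ∀ M : Finset T, M.Nonempty → ∀ x : T → ℝ, (∀ t, 0 < x t) →
    P {ω | ∀ t ∈ M, X t ω ≤ x t} = ENNReal.ofReal (Real.exp
      (-∑ L ∈ M.powerset with L.Nonempty, tauCoeff θ M L * ⨆ t : L, 1 / x t))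

/-! ### The power set as a Cantor cube, and the integral representation -/

/-- The power set of `T`. A type synonym of `Set T`, because it carries the Borel σ-algebra of
the Cantor cube, which for uncountable `T` is larger than the product σ-algebra on `Set T`. -/
def PowerSpace (T : Type*) : Type _ := Set T

namespace PowerSpace

instance (T : Type*) : Membership T (PowerSpace T) := inferInstanceAs (Membership T (Set T))

open Classical in
/-- The topology generated by the maps `Q ↦ 1_{t ∈ Q}`, i.e. that of `{0,1}^T`. -/
instance (T : Type*) : TopologicalSpace (PowerSpace T) :=
  TopologicalSpace.induced (fun (Q : PowerSpace T) (t : T) => decide (t ∈ Q)) Pi.topologicalSpace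

instance (T : Type*) : MeasurableSpace (PowerSpace T) := borel _

instance (T : Type*) : BorelSpace (PowerSpace T) := ⟨rfl⟩

/-- The power set of `T` without the empty set, with the subspace structures. -/
abbrev Nonempty (T : Type*) : Type _ := {Q : PowerSpace T // ∃ t, t ∈ Q}

end PowerSpace

/-- `μ` is a Radon measure on `𝒫(T) \ {∅}` (finite on compact sets and inner regular) with
`θ(A) = μ {Q | A ∩ Q ≠ ∅}` for all finite `A ⊆ T`. -/
structure IsIntegralRepresentation {T : Type*} (θ : Finset T → ℝ)
    (μ : Measure (PowerSpace.Nonempty T)) : Prop where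
  finite_on_compacts : IsFiniteMeasureOnCompacts μ
  inner_regular : μ.InnerRegular
  measure_hit_ne_top : ∀ A : Finset T, μ {Q | ∃ t ∈ A, t ∈ Q.1} ≠ ∞
  measure_hit : ∀ A : Finset T, θ A = (μ {Q | ∃ t ∈ A, t ∈ Q.1}).toReal

/-! ### Poisson point processes and spectral representations -/

/-- The law of a Poisson random variable with mean `r ∈ [0, ∞]`
(for `r = ∞` it is `∞` almost surely). -/
def extPoisson (r : ℝ≥0∞) : Measure ℕ∞ :=
  if r = ∞ then Measure.dirac ⊤ else (poissonMeasure r.toNNReal).map (Nat.cast : ℕ → ℕ∞)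

/-- The random set `Π` of points of `E` is a Poisson point process with intensity `lam`: the
number of points in a measurable set `B` is Poisson with mean `lam B`, and the numbers of points
in finitely many pairwise disjoint measurable sets are independent. -/
structure IsPoissonPointProcess {Ω E : Type*} [MeasurableSpace Ω] [MeasurableSpace E]
    (Pi : Ω → Set E) (P : Measure Ω) (lam : Measure E) : Prop where
  hasLaw : ∀ B : Set E, MeasurableSet B →
    HasLaw (fun ω => (Pi ω ∩ B).encard) (extPoisson (lam B)) P
  indep : ∀ (n : ℕ) (B : Fin n → Set E), (∀ i, MeasurableSet (B i)) →
    Pairwise (fun i j => Disjoint (B i) (B j)) →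
      iIndepFun (fun i ω => (Pi ω ∩ B i).encard) P

/-- The measure `u⁻² du` on `[0, ∞)`. -/
def invSqMeasure : Measure ℝ≥0 :=
  ((volume : Measure ℝ).comap ((↑) : ℝ≥0 → ℝ)).withDensity fun u => ((u : ℝ≥0∞) ^ 2)⁻¹

/-- The measure `u⁻² du × ν(dω)` on `[0, ∞) × E`. As `u⁻² du` is σ-finite, taking `ν` as the
outer integral gives a product measure also when `ν` is not σ-finite. -/
def spectralIntensity {E : Type*} [MeasurableSpace E] (ν : Measure E) : Measure (ℝ≥0 × E) :=
  (ν.prod invSqMeasure).map Prod.swap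

/-- The process `⋁_{(U, ω) ∈ Π} U V_t(ω)`, with values in `[0, ∞]`. -/
def poissonMax {T Ω E : Type*} (V : T → E → ℝ≥0) (Pi : Ω → Set (ℝ≥0 × E)) (t : T) (ω : Ω) :
    ℝ≥0∞ :=
  ⨆ p ∈ Pi ω, ((p.1 * V t p.2 : ℝ≥0) : ℝ≥0∞)

/-- `(E, ν, V)` is a spectral representation of the process `X`: the `V t` are measurable with
integral one, a Poisson point process with intensity `u⁻² du × ν(dω)` exists, and for every
such process `Π` (on any probability space) `X` has the law of `{⋁_{(U, ω) ∈ Π} U V_t(ω)}_t`.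
Both processes are compared as `[-∞, ∞]`-valued processes. -/
structure IsSpectralRepresentation.{a, b, c, d} {T : Type b} {Ω : Type c} [MeasurableSpace Ω]
    {E : Type a} [MeasurableSpace E] (X : T → Ω → ℝ) (P : Measure Ω) (ν : Measure E)
    (V : T → E → ℝ≥0) : Prop where
  measurable : ∀ t, Measurable (V t)
  lintegral_eq_one : ∀ t, ∫⁻ e, V t e ∂ν = 1
  exists_poisson : ∃ (Ω' : Type a) (_ : MeasurableSpace Ω') (P' : Measure Ω')
    (Pi : Ω' → Set (ℝ≥0 × E)), IsProbabilityMeasure P' ∧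
      IsPoissonPointProcess Pi P' (spectralIntensity ν)
  sameLaw : ∀ (Ω' : Type d) [MeasurableSpace Ω'] (P' : Measure Ω') [IsProbabilityMeasure P']
    (Pi : Ω' → Set (ℝ≥0 × E)), IsPoissonPointProcess Pi P' (spectralIntensity ν) →
      SameLaw (fun t ω => ((X t ω : ℝ) : EReal)) P
        (fun t ω => ((poissonMax V Pi t ω : ℝ≥0∞) : EReal)) P'

open Classical in
/-- The spectral functions `V_t(Q) = 1_{t ∈ Q}`. -/
def memIndicator {T : Type*} (t : T) (Q : PowerSpace T) : ℝ≥0 := if t ∈ Q then 1 else 0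

end

/-! Existence of the measure. Let `Q n` be the random set of indices where the process exceeds `n`.
Fréchet margins give `-log P(X_s ≤ n) = 1 / n`, and `1 - p` is asymptotic to `-log p` as `p → 1`, so
`n P(Q n hits A) → θ A`. The measure is thus a vague limit of the laws of `Q n` scaled by `n`. The
non-empty sets form a locally compact, totally disconnected space whose compact sets are controlled
by the sets `hit A`. An ultrafilter limit of the scaled laws is finitely additive on compact open
cylinders and extends to a Radon measure (`exists_radon_of_tendsto_hit`,
`exists_radon_of_cylinder`).

Uniqueness. The values on hitting sets determine those on cylinders by a π-system argument, then on
compact sets by outer approximation, then everywhere by inner regularity (`eq_of_measure_hit_eq`).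

Existence of the Poisson process. For uncountable `T` the measure need not be σ-finite. A well-order
on `T` cuts the space into the compact sets `leastEq t`, and a Radon measure is the sum of its
finite restrictions to them (`sum_restrict_leastEq`). On each finite piece one takes a Poisson
number of i.i.d. points. Superposing uncountably many pieces requires uncountable unions of null
events to be null. This is arranged by enlarging the product σ-algebra
(`exists_measurePreserving_infinitePi`), and then only countably many pieces matter for a set of
finite intensity.

Equality of laws. The Poisson maxima stay below `x` on `M` exactly when no point falls in `exceedSet
M x`, an event of probability `exp(-intensity)`. Inclusion–exclusion identifies `tauCoeff θ M L`
with the mass of `{Q | Q ∩ M = L}`, which turns the intensity into the exponent of the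
Tawn–Molchanov process (`tauCoeff_eq`, `spectralIntensity_exceedSet`). -/

noncomputable section

/-! ### Adding null sets to a product probability measure -/

/-- A probability measure extends to a larger σ-algebra on which all members of a given σ-directed
family of sets of inner measure zero become null. -/
theorem exists_extension_null {Ω ι : Type*} [Nonempty ι] [mΩ : MeasurableSpace Ω] (P : Measure Ω)
    (N : ι → Set Ω) (hdir : ∀ a : ℕ → ι, ∃ b, ∀ n, N (a n) ⊆ N b)
    (hnull : ∀ a G, MeasurableSet G → G ⊆ N a → P G = 0) :
    ∃ (m' : MeasurableSpace Ω) (P' : @Measure Ω m'), mΩ ≤ m' ∧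
      (∀ E, MeasurableSet[mΩ] E → P' E = P E) ∧ ∀ a, P' (N a) = 0 := by
  -- A set may be reduced by any member of the family before it is measured. Directedness supplies
  -- one member serving countably many sets at once, whence countable subadditivity.
  let m : OuterMeasure Ω :=
    { measureOf := fun S => ⨅ a, P (S \ N a)
      empty := by simp
      mono := fun {s t} h => iInf_mono fun a => measure_mono (Set.sdiff_subset_sdiff_left h)
      iUnion_nat := by
        intro s _
        refine ENNReal.le_of_forall_pos_le_add fun ε hε hlt => ?_
        obtain ⟨δ, hδ, hsum⟩ := ENNReal.exists_pos_sum_of_countable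
          (ENNReal.coe_ne_zero.2 hε.ne') ℕ
        have hfin : ∀ n, ⨅ a, P (s n \ N a) ≠ ∞ := fun n =>
          ((ENNReal.le_tsum n).trans_lt hlt).ne
        have hex : ∀ n, ∃ a, P (s n \ N a) < (⨅ a, P (s n \ N a)) + δ n := fun n =>
          iInf_lt_iff.1 (ENNReal.lt_add_right (hfin n) (ENNReal.coe_ne_zero.2 (hδ n).ne'))
        choose a ha using hex
        obtain ⟨b, hb⟩ := hdir a
        calc ⨅ a, P ((⋃ n, s n) \ N a) ≤ P ((⋃ n, s n) \ N b) := iInf_le _ b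
          _ ≤ P (⋃ n, (s n \ N (a n))) := by
            refine measure_mono ?_
            rintro ω ⟨hω, hωb⟩
            obtain ⟨n, hn⟩ := Set.mem_iUnion.1 hω
            exact Set.mem_iUnion.2 ⟨n, hn, fun h => hωb (hb n h)⟩
          _ ≤ ∑' n, P (s n \ N (a n)) := measure_iUnion_le _
          _ ≤ ∑' n, ((⨅ a, P (s n \ N a)) + δ n) := ENNReal.tsum_le_tsum fun n => (ha n).le
          _ = ∑' n, (⨅ a, P (s n \ N a)) + ∑' n, (δ n : ℝ≥0∞) := ENNReal.tsum_add
          _ ≤ _ := by gcongr }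
  have hm : ∀ S, m S = ⨅ a, P (S \ N a) := fun S => rfl
  have hmN : ∀ a, m (N a) = 0 := fun a =>
    le_antisymm ((iInf_le _ a).trans (by simp)) bot_le
  have hle : mΩ ≤ m.caratheodory := by
    intro E hE
    refine (OuterMeasure.isCaratheodory_iff_le m).2 fun S => ?_
    rw [hm S]
    refine le_iInf fun a => ?_
    rw [← measure_inter_add_sdiff (S \ N a) hE]
    refine add_le_add ((iInf_le _ a).trans (measure_mono ?_))
      ((iInf_le _ a).trans (measure_mono ?_))
    · rintro ω ⟨⟨h1, h2⟩, h3⟩; exact ⟨⟨h1, h3⟩, h2⟩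
    · rintro ω ⟨⟨h1, h2⟩, h3⟩; exact ⟨⟨h1, h3⟩, h2⟩
  refine ⟨m.caratheodory, @OuterMeasure.toMeasure Ω m.caratheodory m le_rfl, hle, fun E hE => ?_, fun a => ?_⟩
  · rw [@toMeasure_apply Ω m.caratheodory m le_rfl _ (hle E hE), hm]
    refine le_antisymm ((iInf_le _ (Classical.arbitrary ι)).trans (measure_mono Set.sdiff_subset))
      (le_iInf fun a => ?_)
    obtain ⟨F, hF, hFm, hFe⟩ := exists_measurable_superset P (E \ N a)
    rw [← hFe]
    -- The measurable set `E \ F` lies inside `N a`, so inner measure zero applies to it.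
    have h0 : P (E \ F) = 0 := hnull a _ (hE.diff hFm) fun ω hω => by
      by_contra h
      exact hω.2 (hF ⟨hω.1, h⟩)
    calc P E ≤ P (F ∪ E \ F) := measure_mono fun ω hω => by
            by_cases h : ω ∈ F
            · exact Or.inl h
            · exact Or.inr ⟨hω, h⟩
      _ ≤ P F + P (E \ F) := measure_union_le _ _
      _ = P F := by rw [h0, add_zero]
  · have : MeasurableSet[m.caratheodory] (N a) := by
      refine (OuterMeasure.isCaratheodory_iff_le m).2 fun S => ?_
      calc m (S ∩ N a) + m (S \ N a) ≤ m (N a) + m S :=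
            add_le_add (m.mono Set.inter_subset_right) (m.mono Set.sdiff_subset)
        _ = m S := by rw [hmN, zero_add]
    rw [@toMeasure_apply Ω m.caratheodory m le_rfl _ this, hmN]

theorem measurePreserving_id_of_le {Ω : Type*} {m m' : MeasurableSpace Ω} (hle : m ≤ m')
    {P : @Measure Ω m} {P' : @Measure Ω m'} (h : ∀ E, MeasurableSet[m] E → P' E = P E) :
    @MeasurePreserving Ω Ω m' m id P' P := by
  have hmeas : @Measurable Ω Ω m' m id := measurable_id'' hle
  refine @MeasurePreserving.mk Ω Ω m' m id P' P hmeas (@Measure.ext Ω m _ _ fun E hE => ?_)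
  rw [@Measure.map_apply Ω Ω m' m P' id hmeas E hE]
  exact h E hE

/-- Measurable sets of a product σ-algebra depend on countably many coordinates. -/
theorem MeasurableSet.exists_countable_dependsOn {J : Type*} {Ω : J → Type*}
    [∀ j, MeasurableSpace (Ω j)] {G : Set (∀ j, Ω j)} (hG : MeasurableSet G) :
    ∃ C : Set J, C.Countable ∧ ∀ ω ω', (∀ j ∈ C, ω j = ω' j) → (ω ∈ G ↔ ω' ∈ G) := by
  rw [← generateFrom_measurableCylinders] at hG
  induction G, hG using MeasurableSpace.generateFrom_induction with
  | hC t ht _ =>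
    obtain ⟨s, S, _, rfl⟩ := (mem_measurableCylinders t).1 ht
    refine ⟨s, s.countable_toSet, fun ω ω' h => ?_⟩
    have : s.restrict ω = s.restrict ω' := funext fun j => h j j.2
    simp only [mem_cylinder, this]
  | empty => exact ⟨∅, Set.countable_empty, fun _ _ _ => Iff.rfl⟩
  | compl t _ ih =>
    obtain ⟨C, hC, h⟩ := ih
    exact ⟨C, hC, fun ω ω' hω => not_congr (h ω ω' hω)⟩
  | iUnion f _ ih =>
    choose C hC h using ih
    refine ⟨⋃ n, C n, Set.countable_iUnion hC, fun ω ω' hω => ?_⟩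
    simp only [Set.mem_iUnion]
    exact exists_congr fun n => h n ω ω' fun j hj => hω j (Set.mem_iUnion.2 ⟨n, hj⟩)

/-- Independent random elements with prescribed laws can be realised in such a way that arbitrary
(possibly uncountable) unions of null events about single coordinates are null. -/
theorem exists_measurePreserving_infinitePi {J : Type u} {Ω : J → Type v}
    [∀ j, MeasurableSpace (Ω j)] (P : ∀ j, Measure (Ω j)) [∀ j, IsProbabilityMeasure (P j)] :
    ∃ (Ω' : Type (max u v)) (_ : MeasurableSpace Ω') (P' : Measure Ω') (φ : Ω' → ∀ j, Ω j),
      MeasurePreserving φ P' (Measure.infinitePi P) ∧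
      ∀ A : ∀ j, Set (Ω j), (∀ j, P j (A j) = 0) → P' {ω | ∃ j, φ ω j ∈ A j} = 0 := by
  let ι := {A : ∀ j, Set (Ω j) // ∀ j, P j (A j) = 0}
  have : Nonempty ι := ⟨⟨fun _ => ∅, fun _ => measure_empty⟩⟩
  have hdir : ∀ a : ℕ → ι, ∃ b : ι, ∀ n, {ω : ∀ j, Ω j | ∃ j, ω j ∈ (a n).1 j} ⊆
      {ω | ∃ j, ω j ∈ b.1 j} := by
    intro a
    refine ⟨⟨fun j => ⋃ n, (a n).1 j, fun j => measure_iUnion_null fun n => (a n).2 j⟩, ?_⟩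
    rintro n ω ⟨j, hj⟩
    exact ⟨j, Set.mem_iUnion.2 ⟨n, hj⟩⟩
  have hnull : ∀ (A : ι) (G : Set (∀ j, Ω j)), MeasurableSet G → G ⊆ {ω | ∃ j, ω j ∈ A.1 j} →
      Measure.infinitePi P G = 0 := by
    intro A G hG hGA
    obtain ⟨C, hC, h⟩ := hG.exists_countable_dependsOn
    have hne : ∀ j, ∃ x, x ∉ A.1 j := fun j => by
      by_contra! hcon
      have : A.1 j = Set.univ := Set.eq_univ_of_forall hcon
      simpa [this] using A.2 j
    choose x hx using hne
    have hsub : G ⊆ ⋃ j ∈ C, (fun ω : ∀ j, Ω j => ω j) ⁻¹' A.1 j := by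
      classical
      intro ω hω
      by_contra hcon
      simp only [Set.mem_iUnion, Set.mem_preimage, not_exists] at hcon
      -- Coordinates outside `C` do not affect membership in `G`, so they may be moved off the sets
      -- `A j`. A coordinate in its `A j` must then belong to the countable set `C`.
      let ω' : ∀ j, Ω j := fun j => if j ∈ C then ω j else x j
      have hω' : ω' ∈ G := (h ω ω' fun j hj => by simp [ω', hj]).1 hω
      obtain ⟨j, hj⟩ := hGA hω'
      by_cases hjC : j ∈ C
      · exact hcon j hjC (by simpa [ω', hjC] using hj)
      · exact hx j (by simpa [ω', hjC] using hj)
    refine measure_mono_null hsub ((measure_biUnion_null_iff hC).2 fun j _ => ?_)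
    exact (measurePreserving_eval_infinitePi P j).quasiMeasurePreserving.preimage_null (A.2 j)
  obtain ⟨m', P', h1, h2, h3⟩ := exists_extension_null (Measure.infinitePi P)
    (fun A : ι => {ω | ∃ j, ω j ∈ A.1 j}) hdir hnull
  exact ⟨∀ j, Ω j, m', P', id, measurePreserving_id_of_le h1 h2, fun A hA => h3 ⟨A, hA⟩⟩

/-! ### Poisson point processes with finite intensity -/

theorem iIndepFun_const {Ω ι β : Type*} [MeasurableSpace Ω] [MeasurableSpace β] (P : Measure Ω)
    [IsProbabilityMeasure P] (c : β) : iIndepFun (fun (_ : ι) (_ : Ω) => c) P := by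
  rw [iIndepFun_iff_measure_inter_preimage_eq_mul]
  intro S A _
  by_cases h : ∀ i ∈ S, c ∈ A i
  · rw [Finset.prod_eq_one]
    · rw [← measure_univ (μ := P)]
      congr 1
      exact Set.eq_univ_of_forall fun ω => Set.mem_iInter₂.2 h
    · intro i hi
      rw [Set.preimage_const_of_mem (h i hi), measure_univ]
  · push Not at h
    obtain ⟨i, hi, hc⟩ := h
    rw [Finset.prod_eq_zero hi]
    · exact measure_mono_null (Set.biInter_subset_of_mem hi) (by simp [hc])
    · simp [hc]

/-! ### Counting the points of a finite sample. -/

section SampleCount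

variable {E : Type*}

open Classical in
/-- The number of the first `ω.1` points of the sequence `ω.2` that lie in `B`. -/
def sampleCount (B : Set E) (ω : ℕ × (ℕ → E)) : ℕ :=
  ((Finset.range ω.1).filter fun k => ω.2 k ∈ B).card

theorem sampleCount_eq_sum (B : Set E) (ω : ℕ × (ℕ → E)) :
    (sampleCount B ω : ℝ) = ∑ k ∈ Finset.range ω.1, B.indicator 1 (ω.2 k) := by
  classical
  rw [sampleCount, Finset.card_filter]
  push_cast
  rfl

/-- At most one indicator is non-zero at `x`. This additivity makes the joint characteristic
function of the counts factorise. -/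
theorem cexp_sum_indicator_sub_one {n : ℕ} {B : Fin n → Set E}
    (hd : Pairwise fun i j => Disjoint (B i) (B j)) (t : Fin n → ℝ) (x : E) :
    Complex.exp ((∑ i, t i * (B i).indicator 1 x : ℝ) * Complex.I) - 1 =
      ∑ i, (B i).indicator (fun _ => Complex.exp (t i * Complex.I) - 1) x := by
  by_cases h : ∃ i, x ∈ B i
  · obtain ⟨i, hi⟩ := h
    have hne : ∀ j, j ≠ i → x ∉ B j := fun j hj hx => (Set.disjoint_left.1 (hd hj)) hx hi
    rw [Finset.sum_eq_single i, Finset.sum_eq_single i]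
    · simp [hi]
    · intro j _ hj; simp [hne j hj]
    · simp
    · intro j _ hj; simp [hne j hj]
    · simp
  · push Not at h
    simp [h]

/-- The set of sampled points, emptied when two of them have the same value under `f`. -/
def samplePoints (f : E → ℝ≥0) (ω : ℕ × (ℕ → E)) : Set E :=
  {x | Function.Injective (fun k => f (ω.2 k)) ∧ ∃ k < ω.1, ω.2 k = x}

-- A set forgets multiplicities, so its cardinality counts the sample only if the points are
-- distinct. Distinctness is tested through `f`, because the diagonal of `E` need not be measurable;
-- emptying the set otherwise keeps all counts measurable.
open Classical in
theorem encard_samplePoints_inter (f : E → ℝ≥0) (B : Set E) (ω : ℕ × (ℕ → E)) :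
    (samplePoints f ω ∩ B).encard =
      if Function.Injective (fun k => f (ω.2 k)) then (sampleCount B ω : ℕ∞) else 0 := by
  split_ifs with h
  · have hinj : Function.Injective ω.2 := fun i j hij => h (congrArg f hij)
    have : samplePoints f ω ∩ B =
        ω.2 '' ((Finset.range ω.1).filter fun k => ω.2 k ∈ B : Finset ℕ) := by
      ext x
      simp only [samplePoints, h, true_and, Set.mem_inter_iff, Set.mem_ofPred_eq, Set.mem_image,
        Finset.coe_filter, Finset.mem_range]
      constructor
      · rintro ⟨⟨k, hk, rfl⟩, hx⟩; exact ⟨k, ⟨hk, hx⟩, rfl⟩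
      · rintro ⟨k, ⟨hk, hx⟩, rfl⟩; exact ⟨⟨k, hk, rfl⟩, hx⟩
    rw [this, hinj.encard_image, Set.encard_coe_eq_coe_finsetCard]
    rfl
  · simp [samplePoints, h]

end SampleCount

/-! ### Characteristic functions of Poisson samples. -/

section CompoundPoisson

variable {E : Type*} [MeasurableSpace E]

/-- The law of a Poisson number together with an independent i.i.d. sequence. -/
def poissonSample (r : ℝ≥0) (q : Measure E) [IsProbabilityMeasure q] : Measure (ℕ × (ℕ → E)) :=
  (poissonMeasure r).prod (Measure.infinitePi fun _ => q)

instance (r : ℝ≥0) (q : Measure E) [IsProbabilityMeasure q] :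
    IsProbabilityMeasure (poissonSample r q) := by
  unfold poissonSample; infer_instance

theorem integral_cexp_sum_range (q : Measure E) [IsProbabilityMeasure q] {g : E → ℝ}
    (hg : Measurable g) (n : ℕ) :
    ∫ z, Complex.exp ((∑ k ∈ Finset.range n, g (z k) : ℝ) * Complex.I)
      ∂(Measure.infinitePi fun _ : ℕ => q) = (∫ x, Complex.exp (g x * Complex.I) ∂q) ^ n := by
  have hind : iIndepFun (fun (k : ℕ) (z : ℕ → E) => g (z k)) (Measure.infinitePi fun _ : ℕ => q) :=
    iIndepFun_infinitePi (fun _ => hg)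
  have h1 := iIndepFun.charFun_map_fun_finsetSum_eq_prod (s := Finset.range n)
    (X := fun (k : ℕ) (z : ℕ → E) => g (z k))
    (fun i _ => (hg.comp (measurable_pi_apply i)).aemeasurable) (hind.restrict _)
  have hsum : Measurable fun z : ℕ → E => ∑ k ∈ Finset.range n, g (z k) :=
    Finset.measurable_fun_sum _ fun k _ => hg.comp (measurable_pi_apply k)
  have h2 := congrFun h1 1
  rw [charFun_apply_real, integral_map hsum.aemeasurable (by fun_prop)] at h2
  simp only [Complex.ofReal_one, one_mul] at h2
  rw [h2, Finset.prod_apply, Finset.prod_congr rfl (g := fun _ => ∫ x, Complex.exp (g x * Complex.I) ∂q)]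
  · simp
  · intro k _
    have : Measure.map (fun z : ℕ → E => g (z k)) (Measure.infinitePi fun _ : ℕ => q) = q.map g := by
      rw [← Function.comp_def, ← Measure.map_map hg (measurable_pi_apply k)]
      congr 1
      exact Measure.infinitePi_map_eval _ k
    rw [this, charFun_apply_real, integral_map (by fun_prop) (by fun_prop)]
    simp

/-- Given `n` points the integral is `c ^ n`, and averaging over the Poisson number sums the
exponential series. -/
theorem integral_cexp_poissonSample (r : ℝ≥0) (q : Measure E) [IsProbabilityMeasure q] {g : E → ℝ}
    (hg : Measurable g) :
    ∫ ω, Complex.exp ((∑ k ∈ Finset.range ω.1, g (ω.2 k) : ℝ) * Complex.I) ∂(poissonSample r q) =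
      Complex.exp (r * (∫ x, Complex.exp (g x * Complex.I) ∂q - 1)) := by
  have hm : Measurable fun ω : ℕ × (ℕ → E) => ∑ k ∈ Finset.range ω.1, g (ω.2 k) := by
    refine measurable_from_prod_countable_right fun n => ?_
    change Measurable fun z : ℕ → E => ∑ k ∈ Finset.range n, g (z k)
    exact Finset.measurable_fun_sum _ fun k _ => hg.comp (measurable_pi_apply k)
  unfold poissonSample
  rw [integral_prod]
  · simp_rw [integral_cexp_sum_range q hg]
    set c := ∫ x, Complex.exp (g x * Complex.I) ∂q
    rw [integral_poissonMeasure]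
    calc ∑' n : ℕ, (Real.exp (-r) * r ^ n / n.factorial : ℝ) • c ^ n
        = ∑' n : ℕ, (Real.exp (-r) : ℂ) * ((r * c) ^ n / n.factorial) := by
          refine tsum_congr fun n => ?_
          rw [Complex.real_smul, mul_pow]
          push_cast
          ring
      _ = (Real.exp (-r) : ℂ) * ∑' n : ℕ, ((r * c) ^ n / n.factorial) := tsum_mul_left
      _ = (Real.exp (-r) : ℂ) * Complex.exp (r * c) := by
          rw [(NormedSpace.expSeries_div_hasSum_exp ((r : ℂ) * c)).tsum_eq, Complex.exp_eq_exp_ℂ]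
      _ = _ := by
          rw [Complex.ofReal_exp, ← Complex.exp_add]
          push_cast
          ring_nf
  · refine Integrable.of_bound (C := 1) ?_ (ae_of_all _ fun ω => ?_)
    · exact (Complex.measurable_exp.comp ((Complex.measurable_ofReal.comp hm).mul_const
        _)).aestronglyMeasurable
    rw [Complex.norm_exp_ofReal_mul_I]

theorem measurable_sampleCount {B : Set E} (hB : MeasurableSet B) :
    Measurable (sampleCount B) := by
  classical
  refine measurable_from_prod_countable_right fun n => ?_
  simp only [sampleCount, Finset.card_filter]
  refine Finset.measurable_sum _ fun k _ => Measurable.ite ?_ measurable_const measurable_const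
  exact measurable_pi_apply k hB

/-- This product formula yields both the Poisson law of a single count (`n = 1`) and the
independence of counts in disjoint sets. -/
theorem integral_cexp_sampleCount (r : ℝ≥0) (q : Measure E) [IsProbabilityMeasure q] {n : ℕ}
    {B : Fin n → Set E} (hB : ∀ i, MeasurableSet (B i))
    (hd : Pairwise fun i j => Disjoint (B i) (B j)) (t : Fin n → ℝ) :
    ∫ ω, Complex.exp ((∑ i, t i * sampleCount (B i) ω : ℝ) * Complex.I) ∂(poissonSample r q) =
      ∏ i, Complex.exp ((r * q.real (B i) : ℝ) * (Complex.exp (t i * Complex.I) - 1)) := by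
  have hi : ∀ i, Measurable fun x => (B i).indicator (1 : E → ℝ) x :=
    fun i => measurable_one.indicator (hB i)
  have h1 : ∀ ω : ℕ × (ℕ → E), ∑ i, t i * (sampleCount (B i) ω : ℝ) =
      ∑ k ∈ Finset.range ω.1, ∑ i, t i * (B i).indicator 1 (ω.2 k) := by
    intro ω
    rw [Finset.sum_comm]
    simp_rw [sampleCount_eq_sum, Finset.mul_sum]
  have hg : Measurable fun x => ∑ i, t i * (B i).indicator (1 : E → ℝ) x :=
    Finset.measurable_sum _ fun i _ => (hi i).const_mul _
  simp_rw [h1]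
  rw [integral_cexp_poissonSample r q hg, ← Complex.exp_sum]
  congr 1
  have h2 : ∫ x, Complex.exp ((∑ i, t i * (B i).indicator 1 x : ℝ) * Complex.I) ∂q - 1 =
      ∫ x, (Complex.exp ((∑ i, t i * (B i).indicator 1 x : ℝ) * Complex.I) - 1) ∂q := by
    rw [integral_sub _ (integrable_const _)]
    · simp
    · refine Integrable.of_bound (C := 1) ?_ (ae_of_all _ fun x => ?_)
      · exact (Complex.measurable_exp.comp ((Complex.measurable_ofReal.comp hg).mul_const
          _)).aestronglyMeasurable
      · rw [Complex.norm_exp_ofReal_mul_I]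
  rw [h2]
  simp_rw [cexp_sum_indicator_sub_one hd]
  rw [integral_finsetSum _ fun i _ => (integrable_const _).indicator (hB i), Finset.mul_sum]
  refine Finset.sum_congr rfl fun i _ => ?_
  rw [integral_indicator_const _ (hB i), Complex.real_smul]
  push_cast
  ring

theorem map_sampleCount (r : ℝ≥0) (q : Measure E) [IsProbabilityMeasure q] {B : Set E}
    (hB : MeasurableSet B) :
    (poissonSample r q).map (sampleCount B) = poissonMeasure (r * (q B).toNNReal) := by
  apply (MeasurableEmbedding.natCast (α := ℝ)).map_injective
  have hmeas := measurable_sampleCount hB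
  apply Measure.ext_of_charFun
  ext t
  rw [charFun_map_cast_poissonMeasure, Measure.map_map (by fun_prop) hmeas, charFun_apply_real,
    integral_map (by fun_prop) (by fun_prop)]
  have := integral_cexp_sampleCount r q (n := 1) (B := fun _ => B) (fun _ => hB)
    (fun i j hij => (hij (Subsingleton.elim i j)).elim) (fun _ => t)
  simp only [Finset.univ_unique, Finset.sum_singleton, Finset.prod_singleton] at this
  simp only [Function.comp_apply, ← Complex.ofReal_mul]
  rw [this]
  rfl

theorem iIndepFun_sampleCount (r : ℝ≥0) (q : Measure E) [IsProbabilityMeasure q] {n : ℕ}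
    {B : Fin n → Set E} (hB : ∀ i, MeasurableSet (B i))
    (hd : Pairwise fun i j => Disjoint (B i) (B j)) :
    iIndepFun (fun i => sampleCount (B i)) (poissonSample r q) := by
  have hmeas := fun i => measurable_sampleCount (hB i)
  have h : iIndepFun (fun i ω => (sampleCount (B i) ω : ℝ)) (poissonSample r q) := by
    rw [iIndepFun_iff_charFun_pi (fun i => by have := hmeas i; fun_prop)]
    intro t
    rw [charFun_apply, integral_map (by fun_prop) (by fun_prop)]
    have h1 : ∀ ω, inner ℝ (WithLp.toLp 2 fun i => (sampleCount (B i) ω : ℝ)) t =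
        ∑ i, t i * sampleCount (B i) ω := fun ω => by
      simp [PiLp.inner_apply]
    simp_rw [h1]
    rw [integral_cexp_sampleCount r q hB hd]
    refine Finset.prod_congr rfl fun i _ => ?_
    have h2 : (poissonSample r q).map (fun ω => (sampleCount (B i) ω : ℝ)) =
        ((poissonSample r q).map (sampleCount (B i))).map (Nat.cast : ℕ → ℝ) := by
      rw [Measure.map_map (by fun_prop) (hmeas i)]; rfl
    rw [h2, map_sampleCount r q (hB i), charFun_map_cast_poissonMeasure]
    rfl
  -- The floor recovers the natural number from its real cast, so independence passes back to `ℕ`.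
  have h3 := h.comp (fun _ x => ⌊x⌋₊) (fun _ => Nat.measurable_floor)
  simpa [Function.comp_def] using h3

/-- By Fubini a second independent point almost surely misses the `f`-fibre of the first, and there
are only countably many pairs. -/
theorem ae_injective_infinitePi {q : Measure E} [IsProbabilityMeasure q] {f : E → ℝ≥0}
    (hf : Measurable f) (hq : ∀ u, q (f ⁻¹' {u}) = 0) :
    ∀ᵐ z ∂(Measure.infinitePi fun _ : ℕ => q), Function.Injective fun k => f (z k) := by
  have hpair : ∀ i j : ℕ, i ≠ j →
      ∀ᵐ z ∂(Measure.infinitePi fun _ : ℕ => q), f (z i) ≠ f (z j) := by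
    intro i j hij
    have hD : MeasurableSet {p : E × E | f p.1 = f p.2} :=
      measurableSet_eq_fun (by fun_prop) (by fun_prop)
    have h := Measure.infinitePi_map_eval_prod (P := fun _ : ℕ => q) hij
    have h0 : (q.prod q) {p : E × E | f p.1 = f p.2} = 0 := by
      rw [Measure.prod_apply hD]
      refine (lintegral_congr fun x => ?_).trans lintegral_zero
      refine (congrArg q ?_).trans (hq (f x))
      ext y; simp [eq_comm]
    rw [← h, Measure.map_apply (by fun_prop) hD] at h0
    exact measure_eq_zero_iff_ae_notMem.1 h0
  have hall : ∀ᵐ z ∂(Measure.infinitePi fun _ : ℕ => q), ∀ i j : ℕ, i ≠ j → f (z i) ≠ f (z j) := by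
    rw [ae_all_iff]; intro i
    rw [ae_all_iff]; intro j
    by_cases hij : i = j
    · simp [hij]
    · filter_upwards [hpair i j hij] with z hz _ using hz
  filter_upwards [hall] with z hz i j hij
  by_contra hne
  exact hz i j hne hij

theorem isPoissonPointProcess_samplePoints (r : ℝ≥0) (q : Measure E) [IsProbabilityMeasure q]
    {f : E → ℝ≥0} (hf : Measurable f) (hq : ∀ u, q (f ⁻¹' {u}) = 0) :
    (∀ B, MeasurableSet B → Measurable fun ω => (samplePoints f ω ∩ B).encard) ∧
      IsPoissonPointProcess (samplePoints f) (poissonSample r q) (r • q) := by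
  classical
  have hae : ∀ B, (fun ω => (samplePoints f ω ∩ B).encard) =ᵐ[poissonSample r q]
      fun ω => (sampleCount B ω : ℕ∞) := by
    intro B
    have h : ∀ᵐ ω ∂(poissonSample r q), Function.Injective fun k => f (ω.2 k) :=
      Measure.quasiMeasurePreserving_snd.ae (ae_injective_infinitePi hf hq)
    filter_upwards [h] with ω hω
    rw [encard_samplePoints_inter, if_pos hω]
  have hmeas : ∀ B, MeasurableSet B → Measurable fun ω => (samplePoints f ω ∩ B).encard := by
    intro B hB
    simp_rw [encard_samplePoints_inter]
    refine Measurable.ite ?_ ?_ measurable_const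
    · have : {ω : ℕ × (ℕ → E) | Function.Injective fun k => f (ω.2 k)} =
          ⋂ (i : ℕ) (j : ℕ) (_ : i ≠ j), {ω | f (ω.2 i) = f (ω.2 j)}ᶜ := by
        ext ω
        simp only [Set.mem_ofPred_eq, Set.mem_iInter, Set.mem_compl_iff]
        exact ⟨fun h i j hij he => hij (h he), fun h i j he => by_contra fun hij => h i j hij he⟩
      rw [this]
      refine MeasurableSet.iInter fun i => MeasurableSet.iInter fun j => MeasurableSet.iInter
        fun _ => (measurableSet_eq_fun ?_ ?_).compl <;> fun_prop
    · exact measurable_from_top.comp (measurable_sampleCount hB)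
  refine ⟨hmeas, ⟨fun B hB => ⟨(hmeas B hB).aemeasurable, ?_⟩, fun n B hB hd => ?_⟩⟩
  · rw [Measure.map_congr (hae B)]
    have h1 : (r • q) B ≠ ∞ := measure_ne_top _ _
    have h2 : ((r • q) B).toNNReal = r * (q B).toNNReal := by
      rw [Measure.smul_apply, ENNReal.smul_def, smul_eq_mul, ENNReal.toNNReal_mul]; simp
    rw [extPoisson, if_neg h1, h2, ← map_sampleCount r q hB,
      Measure.map_map measurable_from_top (measurable_sampleCount hB)]
    rfl
  · have h := (iIndepFun_sampleCount r q hB hd).comp (fun _ k => (k : ℕ∞))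
      (fun _ => measurable_from_top)
    exact h.congr fun i => (hae (B i)).symm

end CompoundPoisson

/-- A finite measure which does not charge the fibres of `f` is the intensity of a Poisson point
process with measurable counts. -/
theorem exists_isPoissonPointProcess_of_isFiniteMeasure {E : Type u} [MeasurableSpace E]
    (m : Measure E) [IsFiniteMeasure m] {f : E → ℝ≥0} (hf : Measurable f)
    (hm : ∀ u, m (f ⁻¹' {u}) = 0) :
    ∃ (Ω : Type u) (_ : MeasurableSpace Ω) (P : Measure Ω) (_ : IsProbabilityMeasure P)
      (Pi : Ω → Set E), (∀ B, MeasurableSet B → Measurable fun ω => (Pi ω ∩ B).encard) ∧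
        IsPoissonPointProcess Pi P m := by
  rcases eq_or_ne m 0 with rfl | h0
  -- The zero measure cannot be normalised to a sampling law; the empty process serves instead.
  · refine ⟨PUnit, inferInstance, Measure.dirac PUnit.unit, inferInstance, fun _ => ∅,
      fun B _ => by simp, fun B _ => ⟨by fun_prop, ?_⟩, fun n B _ _ => ?_⟩
    · have h1 : poissonMeasure 0 = Measure.dirac 0 := by
        refine Measure.ext_of_singleton fun n => ?_
        rw [poissonMeasure_singleton]
        rcases n with _ | n <;> simp
      simp [extPoisson, h1, Measure.map_dirac]
    · simp only [Set.empty_inter, Set.encard_empty]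
      exact iIndepFun_const _ _
  · have hne : NeZero m := ⟨h0⟩
    let q : Measure E := (m Set.univ)⁻¹ • m
    have hq : IsProbabilityMeasure q := isProbabilityMeasureSMul
    have hmq : (m Set.univ).toNNReal • q = m := by
      ext B _
      rw [Measure.smul_apply, Measure.smul_apply, ENNReal.smul_def, smul_eq_mul, smul_eq_mul,
        ENNReal.coe_toNNReal (measure_ne_top _ _), ← mul_assoc,
        ENNReal.mul_inv_cancel (by simpa using h0) (measure_ne_top _ _), one_mul]
    obtain ⟨h1, h2⟩ := isPoissonPointProcess_samplePoints (m Set.univ).toNNReal q hf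
      (fun u => by simp [q, hm])
    rw [hmq] at h2
    exact ⟨ℕ × (ℕ → E), inferInstance, poissonSample _ q, inferInstance, _, h1, h2⟩

/-! ### Superposition of Poisson point processes -/

/-- This is continuity from below of the counting measure. -/
theorem Set.encard_iUnion_of_monotone {α : Type*} {s : ℕ → Set α} (hs : Monotone s) :
    (⋃ n, s n).encard = ⨆ n, (s n).encard := by
  let _ : MeasurableSpace α := ⊤
  have h := hs.measure_iUnion (μ := Measure.count)
  simp only [Measure.count_apply MeasurableSpace.measurableSet_top] at h
  rw [← ENat.toENNReal_iSup] at h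
  exact ENat.toENNReal_inj.1 h

theorem Set.Countable.exists_monotone_finset {α : Type*} {C : Set α} (hC : C.Countable) :
    ∃ F : ℕ → Finset α, Monotone F ∧ ⋃ n, (F n : Set α) = C := by
  classical
  rcases C.eq_empty_or_nonempty with rfl | hne
  · exact ⟨fun _ => ∅, monotone_const, by simp⟩
  · obtain ⟨f, rfl⟩ := hC.exists_eq_range hne
    refine ⟨fun n => (Finset.range n).image f, fun a b hab =>
      Finset.image_subset_image (Finset.range_mono hab), ?_⟩
    ext x
    simp only [Finset.coe_image, Finset.coe_range, Set.mem_iUnion, Set.mem_image, Set.mem_Iio,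
      Set.mem_range]
    exact ⟨fun ⟨n, k, _, h⟩ => ⟨k, h⟩, fun ⟨k, h⟩ => ⟨k + 1, k, Nat.lt_succ_self k, h⟩⟩

/-- Joint independence says that the law is an infinite product, and currying the index carries a
product measure to a product of products. -/
theorem iIndepFun_curry {Ω ι κ : Type*} {𝓧 : ι → κ → Type*} [∀ i j, MeasurableSpace (𝓧 i j)]
    [MeasurableSpace Ω] {P : Measure Ω} {X : (i : ι) → (j : κ) → Ω → 𝓧 i j}
    (mX : ∀ i j, Measurable (X i j))
    (h : iIndepFun (fun (p : (_ : ι) × κ) ω => X p.1 p.2 ω) P) :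
    iIndepFun (fun i ω j => X i j ω) P := by
  have := h.isProbabilityMeasure
  have hp : ∀ i j, IsProbabilityMeasure (P.map (X i j)) :=
    fun i j => Measure.isProbabilityMeasure_map (mX i j).aemeasurable
  rw [iIndepFun_iff_map_fun_eq_infinitePi_map (by fun_prop)]
  have h1 := h.map_fun_eq_infinitePi_map (fun p => mX p.1 p.2)
  have h2 : ∀ i, P.map (fun ω j => X i j ω) = Measure.infinitePi fun j => P.map (X i j) :=
    fun i => (h.precomp (g := fun j : κ => (⟨i, j⟩ : (_ : ι) × κ))
      (fun a b hab => by simpa using hab)).map_fun_eq_infinitePi_map (mX i)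
  simp_rw [h2]
  rw [← Measure.infinitePi_map_piCurry (fun i j => P.map (X i j)), ← h1,
    Measure.map_map (by fun_prop) (by fun_prop)]
  rfl

/-! ### Sums and monotone limits of Poisson laws on `ℕ∞`. -/

theorem extPoisson_zero : extPoisson 0 = Measure.dirac 0 := by
  have h1 : poissonMeasure 0 = Measure.dirac 0 := by
    refine Measure.ext_of_singleton fun n => ?_
    rw [poissonMeasure_singleton]
    rcases n with _ | n <;> simp
  simp [extPoisson, h1, Measure.map_dirac]

instance (r : ℝ≥0∞) : IsProbabilityMeasure (extPoisson r) := by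
  unfold extPoisson
  split_ifs
  · infer_instance
  · exact Measure.isProbabilityMeasure_map (by fun_prop)

theorem extPoisson_coe (r : ℝ≥0) :
    extPoisson r = (poissonMeasure r).map (Nat.cast : ℕ → ℕ∞) := by
  simp [extPoisson]

theorem hasLaw_finsetSum_extPoisson {Ω J : Type*} [MeasurableSpace Ω] {P : Measure Ω}
    {X : J → Ω → ℕ∞} (hX : ∀ j, Measurable (X j)) (hind : iIndepFun X P) {r : J → ℝ≥0}
    (hr : ∀ j, HasLaw (X j) (extPoisson (r j)) P) (F : Finset J) :
    HasLaw (fun ω => ∑ j ∈ F, X j ω) (extPoisson (∑ j ∈ F, r j : ℝ≥0)) P := by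
  classical
  have := hind.isProbabilityMeasure
  induction F using Finset.induction_on with
  | empty =>
    refine ⟨by fun_prop, ?_⟩
    simp [extPoisson_zero]
  | insert a F ha ih =>
    simp_rw [Finset.sum_insert ha]
    rw [extPoisson_coe]
    have hi := (hind.indepFun_finsetSum_of_notMem hX ha).symm
    have h1 := hr a
    rw [extPoisson_coe] at h1 ih
    have h2 := hi.hasLaw_add_map_cast_poissonMeasure h1 (ih.congr (by
      filter_upwards with ω; simp))
    refine h2.congr ?_
    filter_upwards with ω; simp

instance : BorelSpace ℕ∞ := ⟨borel_eq_top_of_countable.symm⟩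

theorem extPoisson_coe_Iic (r : ℝ≥0) (k : ℕ) :
    extPoisson r (Set.Iic (k : ℕ∞)) =
      ENNReal.ofReal (∑ i ∈ Finset.range (k + 1), Real.exp (-r) * r ^ i / i.factorial) := by
  have : (Nat.cast ⁻¹' Set.Iic (k : ℕ∞) : Set ℕ) = (Finset.range (k + 1) : Set ℕ) := by
    ext i; simp
  rw [extPoisson_coe, Measure.map_apply measurable_from_top (by measurability), this,
    ← MeasureTheory.sum_measure_singleton, ENNReal.ofReal_sum_of_nonneg (fun i _ => by positivity)]
  simp_rw [poissonMeasure_singleton]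

theorem tendsto_extPoisson_Iic {r : ℕ → ℝ≥0} {b : ℝ≥0∞}
    (h : Tendsto (fun n => (r n : ℝ≥0∞)) atTop (𝓝 b)) (k : ℕ) :
    Tendsto (fun n => extPoisson (r n) (Set.Iic (k : ℕ∞))) atTop
      (𝓝 (extPoisson b (Set.Iic (k : ℕ∞)))) := by
  simp_rw [extPoisson_coe_Iic]
  rcases eq_or_ne b ∞ with rfl | hb
  · have h0 : extPoisson ∞ (Set.Iic (k : ℕ∞)) = ENNReal.ofReal (∑ i ∈ Finset.range (k + 1), 0) := by
      simp [extPoisson]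
    rw [h0]
    have hr : Tendsto (fun n => (r n : ℝ)) atTop atTop := by
      rw [NNReal.tendsto_coe_atTop]
      exact ENNReal.tendsto_coe_nhds_top.1 h
    refine ENNReal.tendsto_ofReal (tendsto_finsetSum _ fun i _ => ?_)
    have := ((Real.tendsto_pow_mul_exp_neg_atTop_nhds_zero i).comp hr).div_const (i.factorial : ℝ)
    simpa [Function.comp_def, mul_comm] using this
  · lift b to ℝ≥0 using hb
    rw [extPoisson_coe_Iic]
    have hr : Tendsto r atTop (𝓝 b) := ENNReal.tendsto_coe.1 h
    have hr' : Tendsto (fun n => (r n : ℝ)) atTop (𝓝 (b : ℝ)) := NNReal.tendsto_coe.2 hr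
    refine ENNReal.tendsto_ofReal (tendsto_finsetSum _ fun i _ => ?_)
    exact (((Real.continuous_exp.tendsto _).comp hr'.neg).mul (hr'.pow i)).div_const _

/-- The event `{sup ≤ k}` is a decreasing intersection, and Poisson distribution functions at finite
`k` depend continuously on the mean, tending to `0` when the mean tends to `∞`. -/
theorem hasLaw_iSup_extPoisson {Ω : Type*} [MeasurableSpace Ω] {P : Measure Ω}
    [IsProbabilityMeasure P] {X : ℕ → Ω → ℕ∞} (hX : ∀ n, Measurable (X n))
    (hmono : ∀ ω, Monotone fun n => X n ω) {r : ℕ → ℝ≥0} {b : ℝ≥0∞}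
    (hr : ∀ n, HasLaw (X n) (extPoisson (r n)) P)
    (h : Tendsto (fun n => (r n : ℝ≥0∞)) atTop (𝓝 b)) :
    HasLaw (fun ω => ⨆ n, X n ω) (extPoisson b) P := by
  have hm : Measurable fun ω => ⨆ n, X n ω := Measurable.iSup hX
  refine ⟨hm.aemeasurable, ?_⟩
  have : IsProbabilityMeasure (P.map fun ω => ⨆ n, X n ω) :=
    Measure.isProbabilityMeasure_map hm.aemeasurable
  refine Measure.ext_of_Iic _ _ fun a => ?_
  induction a using ENat.recTopCoe with
  | top => simp
  | coe k =>
    rw [Measure.map_apply hm (by measurability)]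
    have h1 : (fun ω => ⨆ n, X n ω) ⁻¹' Set.Iic (k : ℕ∞) = ⋂ n, X n ⁻¹' Set.Iic (k : ℕ∞) := by
      ext ω; simp
    rw [h1]
    refine tendsto_nhds_unique (tendsto_measure_iInter_atTop (fun n =>
      (hX n (by measurability)).nullMeasurableSet) ?_ ⟨0, measure_ne_top _ _⟩) ?_
    · intro m n hmn ω hω
      exact (hmono ω hmn).trans hω
    · refine (tendsto_extPoisson_Iic h k).congr fun n => ?_
      rw [← (hr n).map_eq, Measure.map_apply (hX n) (by measurability)]
      rfl

theorem IsPoissonPointProcess.inter {Ω E : Type*} [MeasurableSpace Ω] [MeasurableSpace E]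
    {Pi : Ω → Set E} {P : Measure Ω} {m : Measure E} (h : IsPoissonPointProcess Pi P m)
    {S : Set E} (hS : MeasurableSet S) (hm : m Sᶜ = 0) :
    IsPoissonPointProcess (fun ω => Pi ω ∩ S) P m := by
  refine ⟨fun B hB => ?_, fun n B hB hd => ?_⟩
  · have h1 := h.hasLaw (S ∩ B) (hS.inter hB)
    have h2 : m (S ∩ B) = m B := by
      rw [Set.inter_comm]; exact measure_inter_conull hm
    simpa only [Set.inter_assoc, h2] using h1
  · have h1 := h.indep n (fun i => S ∩ B i) (fun i => hS.inter (hB i))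
      fun i j hij => (hd hij).mono Set.inter_subset_right Set.inter_subset_right
    simpa only [Set.inter_assoc] using h1

theorem iIndepFun.comp_measurePreserving {Ω Ω' ι : Type*} {β : ι → Type*} [MeasurableSpace Ω]
    [MeasurableSpace Ω'] [∀ i, MeasurableSpace (β i)] {P : Measure Ω} {P' : Measure Ω'}
    {X : ∀ i, Ω → β i} {φ : Ω' → Ω} (h : iIndepFun X P) (hX : ∀ i, Measurable (X i))
    (hφ : MeasurePreserving φ P' P) : iIndepFun (fun i ω => X i (φ ω)) P' := by
  rw [iIndepFun_iff_measure_inter_preimage_eq_mul] at h ⊢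
  intro T A hA
  have h2 := h T hA
  have hpre : ∀ i ∈ T, MeasurableSet (X i ⁻¹' A i) := fun i hi => hX i (hA i hi)
  rw [← hφ.measure_preimage (Finset.measurableSet_biInter _ hpre).nullMeasurableSet,
    Finset.prod_congr rfl fun i hi =>
      (hφ.measure_preimage (hpre i hi).nullMeasurableSet).symm] at h2
  simp only [Set.preimage_iInter] at h2
  exact h2

/-! ### Counts in countable superpositions. -/

section EncardUnion

variable {E J : Type*} {Ω : J → Type*} {Pi : ∀ j, Ω j → Set E} {S : J → Set E}

theorem encard_biUnion_finset_inter (hsub : ∀ j ω, Pi j ω ⊆ S j)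
    (hd : Pairwise fun i j => Disjoint (S i) (S j)) (F : Finset J) (B : Set E) (ω : ∀ j, Ω j) :
    ((⋃ j ∈ F, Pi j (ω j)) ∩ B).encard = ∑ j ∈ F, (Pi j (ω j) ∩ B).encard := by
  classical
  induction F using Finset.induction_on with
  | empty => simp
  | insert a F ha ih =>
    rw [Finset.set_biUnion_insert, Set.union_inter_distrib_right, Set.encard_union_eq,
      Finset.sum_insert ha, ih]
    refine Disjoint.mono Set.inter_subset_left Set.inter_subset_left ?_
    refine Set.disjoint_iUnion₂_right.2 fun j hj => ?_
    exact (hd (by rintro rfl; exact ha hj)).mono (hsub a _) (hsub j _)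

theorem encard_biUnion_inter_eq_iSup (hsub : ∀ j ω, Pi j ω ⊆ S j)
    (hd : Pairwise fun i j => Disjoint (S i) (S j)) {C : Set J} {F : ℕ → Finset J}
    (hF : Monotone F) (hFC : ⋃ n, (F n : Set J) = C) (B : Set E) (ω : ∀ j, Ω j) :
    ((⋃ j ∈ C, Pi j (ω j)) ∩ B).encard = ⨆ n, ∑ j ∈ F n, (Pi j (ω j) ∩ B).encard := by
  simp_rw [← encard_biUnion_finset_inter hsub hd]
  rw [← Set.encard_iUnion_of_monotone]
  · congr 1
    subst hFC
    ext x
    simp only [Set.mem_inter_iff, Set.mem_iUnion, Finset.mem_coe]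
    exact ⟨fun ⟨⟨j, ⟨n, hn⟩, hx⟩, hB⟩ => ⟨n, ⟨j, hn, hx⟩, hB⟩,
      fun ⟨n, ⟨j, hn, hx⟩, hB⟩ => ⟨⟨j, ⟨n, hn⟩, hx⟩, hB⟩⟩
  · intro a b hab
    exact Set.inter_subset_inter_left _ (Set.biUnion_subset_biUnion_left fun j hj => hF hab hj)

end EncardUnion

section Superposition

variable {E J : Type*} [MeasurableSpace E] {Ω : J → Type*} [∀ j, MeasurableSpace (Ω j)]
  {P : ∀ j, Measure (Ω j)} [∀ j, IsProbabilityMeasure (P j)] {Pi : ∀ j, Ω j → Set E}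
  {m : J → Measure E} {S : J → Set E}

/-- The number of points in `B` of a countable superposition is measurable. -/
theorem measurable_encard_biUnion_inter (hsub : ∀ j ω, Pi j ω ⊆ S j)
    (hd : Pairwise fun i j => Disjoint (S i) (S j))
    (hmeas : ∀ j B, MeasurableSet B → Measurable fun ω => (Pi j ω ∩ B).encard)
    {C : Set J} (hC : C.Countable) {B : Set E} (hB : MeasurableSet B) :
    Measurable fun ω : ∀ j, Ω j => ((⋃ j ∈ C, Pi j (ω j)) ∩ B).encard := by
  obtain ⟨F, hF, hFC⟩ := hC.exists_monotone_finset
  simp_rw [encard_biUnion_inter_eq_iSup hsub hd hF hFC]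
  exact Measurable.iSup fun n => Finset.measurable_fun_sum _ fun j _ =>
    (hmeas j B hB).comp (measurable_pi_apply j)

theorem hasLaw_encard_biUnion_inter (hsub : ∀ j ω, Pi j ω ⊆ S j)
    (hd : Pairwise fun i j => Disjoint (S i) (S j))
    (hmeas : ∀ j B, MeasurableSet B → Measurable fun ω => (Pi j ω ∩ B).encard)
    [∀ j, IsFiniteMeasure (m j)] (hP : ∀ j, IsPoissonPointProcess (Pi j) (P j) (m j))
    {C : Set J} (hC : C.Countable) {B : Set E} (hB : MeasurableSet B) :
    HasLaw (fun ω : ∀ j, Ω j => ((⋃ j ∈ C, Pi j (ω j)) ∩ B).encard)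
      (extPoisson (∑' j : C, m j B)) (Measure.infinitePi P) := by
  classical
  obtain ⟨F, hF, hFC⟩ := hC.exists_monotone_finset
  simp_rw [encard_biUnion_inter_eq_iSup hsub hd hF hFC]
  have hXm : ∀ j, Measurable fun ω : ∀ j, Ω j => (Pi j (ω j) ∩ B).encard :=
    fun j => (hmeas j B hB).comp (measurable_pi_apply j)
  refine hasLaw_iSup_extPoisson (r := fun n => ∑ j ∈ F n, (m j B).toNNReal) (fun n =>
    Finset.measurable_fun_sum _ fun j _ => hXm j) (fun ω a b hab =>
      Finset.sum_le_sum_of_subset (hF hab)) (fun n => ?_) ?_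
  · refine hasLaw_finsetSum_extPoisson (X := fun j (ω : ∀ j, Ω j) => (Pi j (ω j) ∩ B).encard) hXm
      (iIndepFun_infinitePi fun j => hmeas j B hB) (fun j => ?_) (F n)
    rw [ENNReal.coe_toNNReal (measure_ne_top _ _)]
    exact ((hP j).hasLaw B hB).fun_comp (measurePreserving_eval_infinitePi P j).hasLaw
  · have h1 : ∀ n, ((∑ j ∈ F n, (m j B).toNNReal : ℝ≥0) : ℝ≥0∞) = ∑ j ∈ F n, m j B := fun n => by
      push_cast
      exact Finset.sum_congr rfl fun j _ => ENNReal.coe_toNNReal (measure_ne_top _ _)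
    simp_rw [h1]
    rw [ENNReal.tsum_eq_iSup_sum]
    have h2 : ⨆ s : Finset C, ∑ j ∈ s, m j B = ⨆ n, ∑ j ∈ F n, m j B := by
      refine le_antisymm (iSup_le fun s => ?_) (iSup_le fun n => ?_)
      · have : ∃ n, s.map (Function.Embedding.subtype _) ⊆ F n := by
          have hj : ∀ j : C, ∃ n, (j : J) ∈ F n := fun j => by
            have : (j : J) ∈ ⋃ n, (F n : Set J) := by rw [hFC]; exact j.2
            simpa using this
          choose N hN using hj
          refine ⟨s.sup N, fun j hj => ?_⟩
          obtain ⟨a, ha, rfl⟩ := Finset.mem_map.1 hj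
          exact hF (Finset.le_sup ha) (hN a)
        obtain ⟨n, hn⟩ := this
        refine le_trans ?_ (le_iSup _ n)
        exact (Finset.sum_map s (Function.Embedding.subtype (· ∈ C)) fun j => m j B).symm.le.trans
          (Finset.sum_le_sum_of_subset hn)
      · refine le_trans ?_ (le_iSup _ ((F n).subtype (· ∈ C)))
        rw [Finset.sum_subtype_of_mem (fun j => m j B)]
        intro j hj
        rw [← hFC]
        exact Set.mem_iUnion.2 ⟨n, hj⟩
    rw [h2]
    exact tendsto_atTop_iSup fun a b hab => Finset.sum_le_sum_of_subset (hF hab)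

/-- The counts are independent over `j` by the product structure and over `i` by the Poisson
property, hence jointly. Regrouping them by `i` leaves each total a measurable function of its own
group. -/
theorem iIndepFun_encard_biUnion_inter (hsub : ∀ j ω, Pi j ω ⊆ S j)
    (hd : Pairwise fun i j => Disjoint (S i) (S j))
    (hmeas : ∀ j B, MeasurableSet B → Measurable fun ω => (Pi j ω ∩ B).encard)
    (hP : ∀ j, IsPoissonPointProcess (Pi j) (P j) (m j))
    {C : Set J} (hC : C.Countable) {n : ℕ} {B : Fin n → Set E} (hB : ∀ i, MeasurableSet (B i))
    (hBd : Pairwise fun i j => Disjoint (B i) (B j)) :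
    iIndepFun (fun i (ω : ∀ j, Ω j) => ((⋃ j ∈ C, Pi j (ω j)) ∩ B i).encard)
      (Measure.infinitePi P) := by
  obtain ⟨F, hF, hFC⟩ := hC.exists_monotone_finset
  simp_rw [encard_biUnion_inter_eq_iSup hsub hd hF hFC]
  let X : J → Fin n → (∀ j, Ω j) → ℕ∞ := fun j i ω => (Pi j (ω j) ∩ B i).encard
  have hX : ∀ j i, Measurable (X j i) :=
    fun j i => (hmeas j (B i) (hB i)).comp (measurable_pi_apply j)
  have h1 : iIndepFun (fun (p : J × Fin n) ω => X p.1 p.2 ω) (Measure.infinitePi P) := by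
    refine iIndepFun_uncurry' hX ?_ fun j => ?_
    · exact iIndepFun_infinitePi (X := fun j (ω : Ω j) (i : Fin n) => (Pi j ω ∩ B i).encard)
        fun j => measurable_pi_lambda _ fun i => hmeas j (B i) (hB i)
    · exact iIndepFun.comp_measurePreserving ((hP j).indep n B hB hBd)
        (fun i => hmeas j (B i) (hB i)) (measurePreserving_eval_infinitePi P j)
  have h2 : iIndepFun (fun (p : (_ : Fin n) × J) ω => X p.2 p.1 ω) (Measure.infinitePi P) :=
    h1.precomp (g := fun p : (_ : Fin n) × J => (p.2, p.1)) fun a b hab => by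
      obtain ⟨a1, a2⟩ := a
      obtain ⟨b1, b2⟩ := b
      simp only [Prod.mk.injEq] at hab
      obtain ⟨rfl, rfl⟩ := hab
      rfl
  have h3 := iIndepFun_curry (X := fun i j => X j i) (fun i j => hX j i) h2
  exact h3.comp (fun _ x => ⨆ n, ∑ j ∈ F n, x j) fun _ => Measurable.iSup fun n =>
    Finset.measurable_fun_sum _ fun j _ => measurable_pi_apply j

end Superposition

/-- Countably many finite partial sums already exhaust an infinite sum, and a finite sum has
countable support. Applied to intensities, it reduces arbitrary superpositions to countable ones. -/
theorem ENNReal.exists_countable_tsum_eq {J : Type*} (a : J → ℝ≥0∞) :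
    ∃ C : Set J, C.Countable ∧ (∑' j : C, a j = ∑' j, a j) ∧
      (∑' j, a j ≠ ∞ → ∀ j ∉ C, a j = 0) := by
  by_cases h : ∑' j, a j = ∞
  · have h1 : ∀ n : ℕ, ∃ s : Finset J, (n : ℝ≥0∞) < ∑ j ∈ s, a j := fun n => by
      rw [ENNReal.tsum_eq_iSup_sum] at h
      exact iSup_eq_top.1 h n (ENNReal.natCast_lt_top n)
    choose s hs using h1
    refine ⟨⋃ n, (s n : Set J), Set.countable_iUnion fun n => (s n).countable_toSet, ?_,
      fun h' => (h' h).elim⟩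
    rw [h, ← top_le_iff, ← ENNReal.iSup_natCast]
    refine iSup_le fun n => (hs n).le.trans ?_
    rw [← Finset.tsum_subtype (s n) a]
    exact ENNReal.tsum_mono_subtype a (Set.subset_iUnion (fun n => (s n : Set J)) n)
  · refine ⟨Function.support a, Summable.countable_support_ennreal h, ?_, fun _ j hj => ?_⟩
    · exact tsum_subtype_support a
    · simpa using hj

/-- An arbitrary sum of finite measures with disjoint supports, none of which charges the fibres
of `f`, is the intensity of a Poisson point process. -/
theorem exists_isPoissonPointProcess_sum {E J : Type u} [MeasurableSpace E] (m : J → Measure E)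
    [∀ j, IsFiniteMeasure (m j)] {f : E → ℝ≥0} (hf : Measurable f)
    (hm : ∀ j u, m j (f ⁻¹' {u}) = 0) {S : J → Set E} (hS : ∀ j, MeasurableSet (S j))
    (hd : Pairwise fun i j => Disjoint (S i) (S j)) (hmS : ∀ j, m j (S j)ᶜ = 0) :
    ∃ (Ω : Type u) (_ : MeasurableSpace Ω) (P : Measure Ω) (Pi : Ω → Set E),
      IsProbabilityMeasure P ∧ IsPoissonPointProcess Pi P (Measure.sum m) := by
  choose Ω mΩ P hPp Pi₀ hmeas₀ hP₀ using
    fun j => exists_isPoissonPointProcess_of_isFiniteMeasure (m j) hf (hm j)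
  let Pi : ∀ j, Ω j → Set E := fun j ω => Pi₀ j ω ∩ S j
  have hmeas : ∀ j B, MeasurableSet B → Measurable fun ω => (Pi j ω ∩ B).encard := by
    intro j B hB
    simpa only [Pi, Set.inter_assoc] using hmeas₀ j (S j ∩ B) ((hS j).inter hB)
  have hP : ∀ j, IsPoissonPointProcess (Pi j) (P j) (m j) :=
    fun j => (hP₀ j).inter (hS j) (hmS j)
  have hsub : ∀ j ω, Pi j ω ⊆ S j := fun j ω => Set.inter_subset_right
  obtain ⟨Ω', _, P', φ, hφ, hnull⟩ := exists_measurePreserving_infinitePi P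
  have hP' : IsProbabilityMeasure P' := hφ.hasLaw.isProbabilityMeasure
  let N : Set J → Set E → (∀ j, Ω j) → ℕ∞ := fun C B ω => ((⋃ j ∈ C, Pi j (ω j)) ∩ B).encard
  have hNm : ∀ C, C.Countable → ∀ B, MeasurableSet B → Measurable (N C B) :=
    fun C hC B hB => measurable_encard_biUnion_inter hsub hd hmeas hC hB
  have hNlaw : ∀ C, C.Countable → ∀ B, MeasurableSet B →
      HasLaw (fun ω => N C B (φ ω)) (extPoisson (∑' j : C, m j B)) P' := fun C hC B hB =>
    (hasLaw_encard_biUnion_inter hsub hd hmeas hP hC hB).fun_comp hφ.hasLaw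
  -- The count of the full union agrees almost surely with that over any large enough countable `C`.
  -- The freedom in `C` allows finitely many sets `B i` to share one index set.
  have key : ∀ B, MeasurableSet B → ∃ C₀ : Set J, C₀.Countable ∧ ∀ C, C.Countable → C₀ ⊆ C →
      (∑' j : C, m j B = Measure.sum m B) ∧
      (fun ω => ((⋃ j, Pi j (φ ω j)) ∩ B).encard) =ᵐ[P'] fun ω => N C B (φ ω) := by
    intro B hB
    obtain ⟨C₀, hC₀, htsum, hzero⟩ := ENNReal.exists_countable_tsum_eq fun j => m j B
    refine ⟨C₀, hC₀, fun C hC hsubC => ?_⟩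
    have hsumC : ∑' j : C, m j B = ∑' j, m j B :=
      le_antisymm (ENNReal.tsum_comp_le_tsum_of_injective Subtype.val_injective _)
        (htsum ▸ ENNReal.tsum_mono_subtype (fun j => m j B) hsubC)
    refine ⟨hsumC.trans (Measure.sum_apply m hB).symm, ?_⟩
    by_cases htop : ∑' j, m j B = ∞
    -- With infinite intensity the countable part already has infinitely many points almost surely,
    -- and adding the others changes nothing.
    · have hlaw := hNlaw C hC B hB
      rw [hsumC, htop] at hlaw
      have h1 : ∀ᵐ ω ∂P', N C B (φ ω) = ⊤ := by
        rw [hlaw.ae_iff (p := fun x => x = ⊤) (by measurability)]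
        simp [extPoisson]
      filter_upwards [h1] with ω hω
      rw [hω, ← top_le_iff, ← hω]
      exact Set.encard_le_encard (Set.inter_subset_inter_left _
        (Set.iUnion₂_subset fun j _ => Set.subset_iUnion (fun j => Pi j (φ ω j)) j))
    -- Each piece outside `C` has no points in `B` almost surely. There may be uncountably many, so
    -- the enlarged σ-algebra is needed to discard them together.
    · have hA : ∀ j, P j {x | j ∉ C ∧ (Pi j x ∩ B).encard ≠ 0} = 0 := by
        intro j
        by_cases hj : j ∈ C
        · simp [hj]
        · have hlaw := (hP j).hasLaw B hB
          rw [hzero htop j fun h => hj (hsubC h), extPoisson_zero] at hlaw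
          have h1 : ∀ᵐ x ∂(P j), (Pi j x ∩ B).encard = 0 := by
            rw [hlaw.ae_iff (p := fun x => x = 0) (by measurability)]
            simp
          simpa [hj] using ae_iff.1 h1
      have h2 := measure_eq_zero_iff_ae_notMem.1 (hnull _ hA)
      filter_upwards [h2] with ω hω
      change _ = ((⋃ j ∈ C, Pi j (φ ω j)) ∩ B).encard
      congr 1
      ext x
      simp only [Set.mem_inter_iff, Set.mem_iUnion, exists_prop]
      refine ⟨fun ⟨⟨j, hj⟩, hx⟩ => ⟨⟨j, ?_, hj⟩, hx⟩, fun ⟨⟨j, _, hj⟩, hx⟩ => ⟨⟨j, hj⟩, hx⟩⟩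
      by_contra hjC
      refine hω ⟨j, hjC, ?_⟩
      rw [Set.encard_ne_zero]
      exact ⟨x, hj, hx⟩
  refine ⟨Ω', inferInstance, P', fun ω => ⋃ j, Pi j (φ ω j), hP', fun B hB => ?_,
    fun n B hB hBd => ?_⟩
  · obtain ⟨C, hC, h⟩ := key B hB
    obtain ⟨h1, h2⟩ := h C hC subset_rfl
    rw [← h1]
    exact (hNlaw C hC B hB).congr h2
  · choose C hC h using fun i => key (B i) (hB i)
    have hCc : (⋃ i, C i).Countable := Set.countable_iUnion hC
    have hind := iIndepFun_encard_biUnion_inter hsub hd hmeas hP hCc hB hBd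
    have hind' := iIndepFun.comp_measurePreserving hind (fun i => hNm _ hCc (B i) (hB i)) hφ
    exact hind'.congr fun i => ((h i) _ hCc (Set.subset_iUnion C i)).2.symm

/-! ### The topology of the space of non-empty subsets -/

namespace PowerSpace

variable {T : Type*}

open Classical in
theorem continuous_decide_pi :
    Continuous fun (Q : PowerSpace T) (t : T) => decide (t ∈ Q) := continuous_induced_dom

open Classical in
theorem continuous_decide_mem (t : T) :
    Continuous fun Q : PowerSpace T => decide (t ∈ Q) :=
  (continuous_apply t).comp continuous_decide_pi

/-- The subset with a given `Bool`-valued indicator function. -/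
def ofFun (f : T → Bool) : PowerSpace T := ({t | f t = true} : Set T)

theorem mem_ofFun (f : T → Bool) (t : T) : t ∈ ofFun f ↔ f t = true := Iff.rfl

open Classical in
/-- The power set is homeomorphic to the Cantor cube. -/
def homeomorphPiBool (T : Type*) : PowerSpace T ≃ₜ (T → Bool) where
  toFun Q t := decide (t ∈ Q)
  invFun := ofFun
  left_inv Q := Set.ext fun t => decide_eq_true_iff
  right_inv f := funext fun t => by simp [mem_ofFun]
  continuous_toFun := continuous_decide_pi
  continuous_invFun := by
    refine continuous_induced_rng.2 (continuous_pi fun t => ?_)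
    simpa [Function.comp_def, mem_ofFun] using continuous_apply t

instance : CompactSpace (PowerSpace T) := (homeomorphPiBool T).symm.compactSpace

instance : T2Space (PowerSpace T) := (homeomorphPiBool T).symm.t2Space

theorem isClopen_mem (t : T) : IsClopen {Q : PowerSpace T | t ∈ Q} := by
  classical
  have := (isClopen_discrete {true}).preimage (continuous_decide_mem t)
  convert this using 1
  ext Q
  simp

theorem isOpen_nonempty : IsOpen {Q : PowerSpace T | ∃ t, t ∈ Q} := by
  rw [Set.ofPred_exists]
  exact isOpen_iUnion fun t => (isClopen_mem t).isOpen

instance : LocallyCompactSpace (PowerSpace.Nonempty T) := isOpen_nonempty.locallyCompactSpace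

/-- The non-empty sets which hit the finite set `A`. -/
def hit (A : Finset T) : Set (PowerSpace.Nonempty T) := {Q | ∃ t ∈ A, t ∈ Q.1}

theorem isClopen_mem_val (t : T) : IsClopen {Q : PowerSpace.Nonempty T | t ∈ Q.1} :=
  (isClopen_mem t).preimage continuous_subtype_val

/-- The set is closed in the compact cube and avoids `∅`, so deleting that point leaves it compact.
-/
theorem isCompact_mem_val (t : T) : IsCompact {Q : PowerSpace.Nonempty T | t ∈ Q.1} := by
  rw [Topology.IsEmbedding.subtypeVal.isCompact_iff]
  have : Subtype.val '' {Q : PowerSpace.Nonempty T | t ∈ Q.1} = {Q : PowerSpace T | t ∈ Q} := by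
    ext Q
    simp only [Set.mem_image, Set.mem_ofPred_eq]
    exact ⟨fun ⟨R, hR, h⟩ => h ▸ hR, fun h => ⟨⟨Q, t, h⟩, h, rfl⟩⟩
  rw [this]
  exact (isClopen_mem t).isClosed.isCompact

theorem hit_eq_biUnion (A : Finset T) :
    hit A = ⋃ t ∈ A, {Q : PowerSpace.Nonempty T | t ∈ Q.1} := by
  ext Q; simp [hit]

theorem isClopen_hit (A : Finset T) : IsClopen (hit A) := by
  rw [hit_eq_biUnion]
  exact A.finite_toSet.isClopen_biUnion fun t _ => isClopen_mem_val t

theorem isCompact_hit (A : Finset T) : IsCompact (hit A) := by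
  rw [hit_eq_biUnion]
  exact A.isCompact_biUnion fun t _ => isCompact_mem_val t

theorem measurableSet_hit (A : Finset T) : MeasurableSet (hit A) :=
  (isClopen_hit A).isOpen.measurableSet

theorem hit_union [DecidableEq T] (A B : Finset T) : hit (A ∪ B) = hit A ∪ hit B := by
  ext Q
  simp only [hit, Finset.mem_union, Set.mem_ofPred_eq, Set.mem_union]
  grind

/-- The open sets `{t ∈ Q}` cover all non-empty sets. Finiteness on compact sets therefore reduces
to finiteness on hitting sets. -/
theorem exists_subset_hit {K : Set (PowerSpace.Nonempty T)} (hK : IsCompact K) :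
    ∃ A : Finset T, K ⊆ hit A := by
  obtain ⟨A, hA⟩ := hK.elim_finite_subcover (fun t => {Q : PowerSpace.Nonempty T | t ∈ Q.1})
    (fun t => (isClopen_mem_val t).isOpen) fun Q _ => by
      obtain ⟨t, ht⟩ := Q.2
      exact Set.mem_iUnion.2 ⟨t, ht⟩
  exact ⟨A, by rwa [hit_eq_biUnion]⟩

/-- The σ-algebra generated by the membership events. -/
abbrev cylinderSigma (T : Type*) : MeasurableSpace (PowerSpace.Nonempty T) :=
  MeasurableSpace.generateFrom (Set.range fun A : Finset T => (hit A)ᶜ)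

theorem cylinderSigma_le : cylinderSigma T ≤ Subtype.instMeasurableSpace := by
  refine MeasurableSpace.generateFrom_le ?_
  rintro _ ⟨A, rfl⟩
  exact (measurableSet_hit A).compl

theorem measurableSet_cylinderSigma_hit (A : Finset T) : MeasurableSet[cylinderSigma T] (hit A) := by
  rw [← compl_compl (hit A)]
  exact MeasurableSet.compl (MeasurableSpace.measurableSet_generateFrom ⟨A, rfl⟩)

/-- A compact open set in the σ-algebra generated by the membership events. -/
structure IsCylinder (C : Set (PowerSpace.Nonempty T)) : Prop where
  isCompact : IsCompact C
  isOpen : IsOpen C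
  measurableSet : MeasurableSet[cylinderSigma T] C

theorem isCylinder_hit (A : Finset T) : IsCylinder (hit A) :=
  ⟨isCompact_hit A, (isClopen_hit A).isOpen, measurableSet_cylinderSigma_hit A⟩

theorem IsCylinder.union {C D : Set (PowerSpace.Nonempty T)} (hC : IsCylinder C)
    (hD : IsCylinder D) : IsCylinder (C ∪ D) :=
  ⟨hC.isCompact.union hD.isCompact, hC.isOpen.union hD.isOpen,
    hC.measurableSet.union hD.measurableSet⟩

theorem exists_isCylinder_of_mem {U : Set (PowerSpace.Nonempty T)} (hU : IsOpen U)
    {Q : PowerSpace.Nonempty T} (hQ : Q ∈ U) : ∃ C, IsCylinder C ∧ Q ∈ C ∧ C ⊆ U := by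
  classical
  have hind : Topology.IsInducing fun (R : PowerSpace.Nonempty T) (t : T) => decide (t ∈ R.1) :=
    (homeomorphPiBool T).isInducing.comp Topology.IsInducing.subtypeVal
  obtain ⟨V, hV, rfl⟩ := hind.isOpen_iff.1 hU
  obtain ⟨I, u, hu, hsub⟩ := isOpen_pi_iff.1 hV _ hQ
  obtain ⟨t₀, ht₀⟩ := Q.2
  let D : T → Set (PowerSpace.Nonempty T) := fun t => if t ∈ Q.1 then hit {t} else (hit {t})ᶜ
  have hD : ∀ t, MeasurableSet[cylinderSigma T] (D t) ∧ IsClopen (D t) ∧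
      ∀ R, R ∈ D t ↔ (t ∈ R.1 ↔ t ∈ Q.1) := by
    intro t
    by_cases ht : t ∈ Q.1
    · simp only [D, ht, if_true]
      exact ⟨measurableSet_cylinderSigma_hit _, isClopen_hit _, fun R => by simp [hit]⟩
    · simp only [D, ht, if_false]
      exact ⟨(measurableSet_cylinderSigma_hit _).compl, (isClopen_hit _).compl,
        fun R => by simp [hit]⟩
  have hclopen : IsClopen (⋂ t ∈ I, D t) :=
    I.finite_toSet.isClopen_biInter fun t _ => (hD t).2.1
  -- A basic clopen neighbourhood need not be compact once `∅` is removed; intersecting with `hit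
  -- {t₀}` makes it so.
  refine ⟨hit {t₀} ∩ ⋂ t ∈ I, D t, ⟨(isCompact_hit _).inter_right hclopen.isClosed,
    (isClopen_hit _).isOpen.inter hclopen.isOpen, (measurableSet_cylinderSigma_hit _).inter
      (I.measurableSet_biInter fun t _ => (hD t).1)⟩, ⟨by simpa [hit] using ht₀, ?_⟩, ?_⟩
  · exact Set.mem_iInter₂.2 fun t _ => ((hD t).2.2 Q).2 Iff.rfl
  · rintro R ⟨_, hR⟩
    refine hsub fun t ht => ?_
    have h1 := ((hD t).2.2 R).1 (Set.mem_iInter₂.1 hR t ht)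
    have h2 := (hu t ht).2
    simpa only [h1] using h2

theorem exists_isCylinder_between {K U : Set (PowerSpace.Nonempty T)} (hK : IsCompact K)
    (hU : IsOpen U) (hKU : K ⊆ U) : ∃ C, IsCylinder C ∧ K ⊆ C ∧ C ⊆ U := by
  refine hK.induction_on (p := fun s => ∃ C, IsCylinder C ∧ s ⊆ C ∧ C ⊆ U) ?_ ?_ ?_ ?_
  · refine ⟨hit ∅, isCylinder_hit ∅, Set.empty_subset _, ?_⟩
    simp [hit]
  · rintro s t hst ⟨C, hC, h1, h2⟩
    exact ⟨C, hC, hst.trans h1, h2⟩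
  · rintro s t ⟨C, hC, h1, h2⟩ ⟨D, hD, h3, h4⟩
    exact ⟨C ∪ D, hC.union hD, Set.union_subset_union h1 h3, Set.union_subset h2 h4⟩
  · intro Q hQ
    obtain ⟨C, hC, h1, h2⟩ := exists_isCylinder_of_mem hU (hKU hQ)
    exact ⟨C, mem_nhdsWithin_of_mem_nhds (hC.isOpen.mem_nhds h1), C, hC, subset_rfl, h2⟩

/-! ### Radon measures and the least element of a set -/

/-- The sets whose least element, with respect to a fixed well-order, is `t`. -/
def leastEq (t : T) : Set (PowerSpace.Nonempty T) :=
  {Q | t ∈ Q.1 ∧ ∀ s, WellOrderingRel s t → s ∉ Q.1}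

theorem leastEq_eq (t : T) : leastEq t = {Q : PowerSpace.Nonempty T | t ∈ Q.1} \
    ⋃ s ∈ {s | WellOrderingRel s t}, {Q : PowerSpace.Nonempty T | s ∈ Q.1} := by
  ext Q; simp [leastEq]

theorem isCompact_leastEq (t : T) : IsCompact (leastEq t) := by
  rw [leastEq_eq]
  exact (isCompact_mem_val t).diff (isOpen_biUnion fun s _ => (isClopen_mem_val s).isOpen)

theorem measurableSet_leastEq (t : T) : MeasurableSet (leastEq t) :=
  (isCompact_leastEq t).measurableSet

theorem pairwise_disjoint_leastEq :
    Pairwise fun s t : T => Disjoint (leastEq s) (leastEq t) := by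
  intro s t hst
  refine Set.disjoint_left.2 fun Q hs ht => ?_
  rcases trichotomous_of WellOrderingRel s t with h | h | h
  · exact ht.2 s h hs.1
  · exact hst h
  · exact hs.2 t h ht.1

/-- No mass is lost in the possibly uncountable partition by least elements. If the remainder `R`
had mass, take the least `t` for which `R ∩ {t ∈ Q}` is charged. Sets containing something smaller
contribute nothing, and the others lie in `leastEq t`, which `R` meets in a null set. -/
theorem measure_eq_tsum_leastEq (ρ : Measure (PowerSpace.Nonempty T))
    [IsFiniteMeasureOnCompacts ρ] [ρ.InnerRegularCompactLTTop]
    {K : Set (PowerSpace.Nonempty T)} (hK : IsCompact K) :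
    ρ K = ∑' t, ρ (K ∩ leastEq t) := by
  have hKfin : ρ K ≠ ∞ := hK.measure_lt_top.ne
  have hKm := hK.measurableSet
  have hCm : ∀ t : T, MeasurableSet (K ∩ leastEq t) := fun t => hKm.inter (measurableSet_leastEq t)
  have hdisj : Pairwise fun s t : T => Disjoint (K ∩ leastEq s) (K ∩ leastEq t) :=
    fun s t hst => (pairwise_disjoint_leastEq hst).mono Set.inter_subset_right
      Set.inter_subset_right
  have hle : ∑' t, ρ (K ∩ leastEq t) ≤ ρ K :=
    (tsum_meas_le_meas_iUnion_of_disjoint ρ hCm hdisj).trans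
      (measure_mono (Set.iUnion_subset fun t => Set.inter_subset_left))
  let C : Set T := Function.support fun t => ρ (K ∩ leastEq t)
  have hC : C.Countable := Summable.countable_support_ennreal (ne_top_of_le_ne_top hKfin hle)
  let R := K \ ⋃ t ∈ C, leastEq t
  have hRm : MeasurableSet R :=
    hKm.diff (MeasurableSet.biUnion hC fun t _ => measurableSet_leastEq t)
  have hRfin : ρ R ≠ ∞ := ne_top_of_le_ne_top hKfin (measure_mono Set.sdiff_subset)
  have hR : ρ R = 0 := by
    by_contra hne
    have hex : ∃ t, ρ (R ∩ {Q | t ∈ Q.1}) ≠ 0 := by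
      by_contra! hcon
      obtain ⟨A, hA⟩ := exists_subset_hit hK
      refine hne (measure_mono_null (t := ⋃ t ∈ A, R ∩ {Q | t ∈ Q.1}) ?_
        ((measure_biUnion_null_iff A.countable_toSet).2 fun t _ => hcon t))
      intro Q hQ
      obtain ⟨t, ht, htQ⟩ := hA hQ.1
      exact Set.mem_iUnion₂.2 ⟨t, ht, hQ, htQ⟩
    obtain ⟨t, ht, hmin⟩ := WellFounded.has_min (IsWellFounded.wf (r := WellOrderingRel (α := T)))
      {t | ρ (R ∩ {Q | t ∈ Q.1}) ≠ 0} hex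
    let U := ⋃ s ∈ {s | WellOrderingRel s t}, {Q : PowerSpace.Nonempty T | s ∈ Q.1}
    have hU : IsOpen U := isOpen_biUnion fun s _ => (isClopen_mem_val s).isOpen
    -- `U` may be an uncountable union, but a charged compact subset would be covered by finitely
    -- many of its members, each null on `R` by minimality of `t`.
    have hRU : ρ (R ∩ U) = 0 := by
      by_contra hpos
      obtain ⟨K', hK'sub, hK', hlt⟩ := (hRm.inter hU.measurableSet).exists_lt_isCompact_of_ne_top
        (ne_top_of_le_ne_top hRfin (measure_mono Set.inter_subset_left)) (pos_iff_ne_zero.2 hpos)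
      obtain ⟨b, hb, hbfin, hcov⟩ := hK'.elim_finite_subcover_image
        (fun s _ => (isClopen_mem_val s).isOpen) (hK'sub.trans Set.inter_subset_right)
      refine hlt.ne' (measure_mono_null (t := ⋃ s ∈ b, R ∩ {Q | s ∈ Q.1}) ?_
        ((measure_biUnion_null_iff hbfin.countable).2 fun s hs => ?_))
      · intro Q hQ
        obtain ⟨s, hs, hsQ⟩ := Set.mem_iUnion₂.1 (hcov hQ)
        exact Set.mem_iUnion₂.2 ⟨s, hs, (hK'sub hQ).1, hsQ⟩
      · by_contra h
        exact hmin s h (hb hs)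
    have hRD : ρ (R ∩ leastEq t) = 0 := by
      by_cases htC : t ∈ C
      · have : R ∩ leastEq t = ∅ := Set.eq_empty_of_forall_notMem fun Q hQ =>
          hQ.1.2 (Set.mem_iUnion₂.2 ⟨t, htC, hQ.2⟩)
        rw [this, measure_empty]
      · have h0 : ρ (K ∩ leastEq t) = 0 := by simpa [C] using htC
        exact measure_mono_null (Set.inter_subset_inter_left _ Set.sdiff_subset) h0
    refine ht (measure_mono_null (t := R ∩ U ∪ R ∩ leastEq t) ?_ (measure_union_null hRU hRD))
    rintro Q ⟨hQ, hQt⟩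
    by_cases hQU : Q ∈ U
    · exact Or.inl ⟨hQ, hQU⟩
    · exact Or.inr ⟨hQ, by rw [leastEq_eq]; exact ⟨hQt, hQU⟩⟩
  refine le_antisymm ?_ hle
  calc ρ K ≤ ρ ((⋃ t ∈ C, K ∩ leastEq t) ∪ R) := measure_mono fun Q hQ => by
        by_cases h : Q ∈ ⋃ t ∈ C, leastEq t
        · obtain ⟨t, ht, htQ⟩ := Set.mem_iUnion₂.1 h
          exact Or.inl (Set.mem_iUnion₂.2 ⟨t, ht, hQ, htQ⟩)
        · exact Or.inr ⟨hQ, h⟩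
    _ ≤ ρ (⋃ t ∈ C, K ∩ leastEq t) + ρ R := measure_union_le _ _
    _ = ρ (⋃ t ∈ C, K ∩ leastEq t) := by rw [hR, add_zero]
    _ ≤ ∑' t : C, ρ (K ∩ leastEq (t : T)) := measure_biUnion_le ρ hC _
    _ ≤ ∑' t, ρ (K ∩ leastEq t) :=
        ENNReal.tsum_comp_le_tsum_of_injective Subtype.val_injective _

theorem sum_restrict_leastEq (μ : Measure (PowerSpace.Nonempty T))
    [IsFiniteMeasureOnCompacts μ] [μ.InnerRegular] :
    Measure.sum (fun t => μ.restrict (leastEq t)) = μ := by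
  ext B hB
  rw [Measure.sum_apply _ hB]
  simp_rw [Measure.restrict_apply hB]
  refine le_antisymm ((tsum_meas_le_meas_iUnion_of_disjoint μ
    (fun t => hB.inter (measurableSet_leastEq t)) fun s t hst =>
      (pairwise_disjoint_leastEq hst).mono Set.inter_subset_right Set.inter_subset_right).trans
        (measure_mono (Set.iUnion_subset fun t => Set.inter_subset_left))) ?_
  rw [hB.measure_eq_iSup_isCompact]
  refine iSup₂_le fun K hKB => iSup_le fun hK => ?_
  rw [measure_eq_tsum_leastEq μ hK]
  exact ENNReal.tsum_le_tsum fun t => measure_mono (Set.inter_subset_inter_left _ hKB)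

end PowerSpace

namespace PowerSpace

variable {T : Type*}

/-! ### Existence and uniqueness of Radon measures with given values on cylinders -/

/-- Approximating compact sets from outside by cylinders gives a regular content `L`, and hence a
measure agreeing with `l` on cylinders. It is finally modified to be inner regular on all Borel
sets. -/
theorem exists_radon_of_cylinder (l : Set (PowerSpace.Nonempty T) → ℝ≥0∞)
    (hmono : ∀ C D, C ⊆ D → l C ≤ l D) (hunion : ∀ C D, l (C ∪ D) ≤ l C + l D)
    (hdisj : ∀ C D, IsCylinder C → IsCylinder D → Disjoint C D → l C + l D ≤ l (C ∪ D))
    (hfin : ∀ C, IsCylinder C → l C ≠ ∞) :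
    ∃ μ : Measure (PowerSpace.Nonempty T), IsFiniteMeasureOnCompacts μ ∧ μ.InnerRegular ∧
      ∀ C, IsCylinder C → μ C = l C := by
  let L : Set (PowerSpace.Nonempty T) → ℝ≥0∞ :=
    fun K => ⨅ (C) (_ : IsCylinder C) (_ : K ⊆ C), l C
  have hLle : ∀ K C, IsCylinder C → K ⊆ C → L K ≤ l C := fun K C hC h =>
    iInf_le_of_le C (iInf_le_of_le hC (iInf_le _ h))
  have hLlt : ∀ K r, L K < r → ∃ C, IsCylinder C ∧ K ⊆ C ∧ l C < r := fun K r h => by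
    simpa only [L, iInf_lt_iff, exists_prop] using h
  have hLmono : ∀ K K', K ⊆ K' → L K ≤ L K' := fun K K' h =>
    le_iInf₂ fun C hC => le_iInf fun hK => hLle K C hC (h.trans hK)
  have hLcyl : ∀ C, IsCylinder C → L C = l C := fun C hC =>
    le_antisymm (hLle C C hC subset_rfl) (le_iInf₂ fun D _ => le_iInf fun h => hmono C D h)
  have hLfin : ∀ K, IsCompact K → L K ≠ ∞ := fun K hK => by
    obtain ⟨A, hA⟩ := exists_subset_hit hK
    exact ne_top_of_le_ne_top (hfin _ (isCylinder_hit A)) (hLle _ _ (isCylinder_hit A) hA)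
  have hLsup : ∀ K K', L (K ∪ K') ≤ L K + L K' := by
    intro K K'
    refine ENNReal.le_of_forall_pos_le_add fun ε hε hlt => ?_
    have hε2 : ((ε / 2 : ℝ≥0) : ℝ≥0∞) ≠ 0 := by
      simpa using hε.ne'
    obtain ⟨h1, h2⟩ := ENNReal.add_lt_top.1 hlt
    obtain ⟨C, hC, hKC, hlC⟩ := hLlt K _ (ENNReal.lt_add_right h1.ne hε2)
    obtain ⟨D, hD, hKD, hlD⟩ := hLlt K' _ (ENNReal.lt_add_right h2.ne hε2)
    calc L (K ∪ K') ≤ l (C ∪ D) :=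
          hLle _ _ (hC.union hD) (Set.union_subset_union hKC hKD)
      _ ≤ l C + l D := hunion C D
      _ ≤ (L K + (ε / 2 : ℝ≥0)) + (L K' + (ε / 2 : ℝ≥0)) := add_le_add hlC.le hlD.le
      _ = L K + L K' + ((ε / 2 : ℝ≥0) + (ε / 2 : ℝ≥0)) := by ring
      _ = L K + L K' + ε := by rw [← ENNReal.coe_add, add_halves]
  have hLdisj : ∀ K K', IsCompact K → IsCompact K' → Disjoint K K' →
      L (K ∪ K') = L K + L K' := by
    intro K K' hK hK' hd
    refine le_antisymm (hLsup K K') (le_iInf₂ fun C hC => le_iInf fun hKC => ?_)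
    -- Disjoint compact sets are separated by disjoint cylinders inside `C`, where additivity of `l`
    -- is available.
    obtain ⟨D, hD, hKD, hDC⟩ := exists_isCylinder_between hK
      (hC.isOpen.inter hK'.isClosed.isOpen_compl) (U := C ∩ K'ᶜ)
      fun Q hQ => ⟨hKC (Or.inl hQ), Set.disjoint_left.1 hd hQ⟩
    obtain ⟨D', hD', hKD', hDC'⟩ := exists_isCylinder_between hK'
      (hC.isOpen.inter hD.isCompact.isClosed.isOpen_compl) (U := C ∩ Dᶜ)
      fun Q hQ => ⟨hKC (Or.inr hQ), fun h => (hDC h).2 hQ⟩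
    calc L K + L K' ≤ l D + l D' := add_le_add (hLle _ _ hD hKD) (hLle _ _ hD' hKD')
      _ ≤ l (D ∪ D') := hdisj D D' hD hD' (Set.disjoint_left.2 fun Q hQ hQ' => (hDC' hQ').2 hQ)
      _ ≤ l C := hmono _ _ (Set.union_subset (hDC.trans Set.inter_subset_left)
          (hDC'.trans Set.inter_subset_left))
  let c : Content (PowerSpace.Nonempty T) :=
    { toFun := fun K => (L K).toNNReal
      mono' := fun K K' h => ENNReal.toNNReal_mono (hLfin _ K'.isCompact) (hLmono _ _ h)
      sup_disjoint' := fun K K' hd _ _ => by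
        rw [TopologicalSpace.Compacts.coe_sup, hLdisj _ _ K.isCompact K'.isCompact hd,
          ENNReal.toNNReal_add (hLfin _ K.isCompact) (hLfin _ K'.isCompact)]
      sup_le' := fun K K' => by
        rw [TopologicalSpace.Compacts.coe_sup,
          ← ENNReal.toNNReal_add (hLfin _ K.isCompact) (hLfin _ K'.isCompact)]
        exact ENNReal.toNNReal_mono (ENNReal.add_ne_top.2
          ⟨hLfin _ K.isCompact, hLfin _ K'.isCompact⟩) (hLsup _ _) }
  have hc : ∀ K : TopologicalSpace.Compacts (PowerSpace.Nonempty T), c K = L K := fun K =>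
    ENNReal.coe_toNNReal (hLfin _ K.isCompact)
  have hreg : c.ContentRegular := by
    intro K
    refine le_antisymm (le_iInf₂ fun K' h => c.mono _ _ (h.trans interior_subset)) ?_
    rw [hc]
    refine le_iInf₂ fun C hC => le_iInf fun hKC => ?_
    refine (iInf₂_le (⟨C, hC.isCompact⟩ : TopologicalSpace.Compacts (PowerSpace.Nonempty T)) ?_).trans ?_
    · simpa [hC.isOpen.interior_eq] using hKC
    · rw [hc]
      exact (hLcyl C hC).le
  let ρ := c.measure
  have hρ : ∀ C, IsCylinder C → ρ C = l C := fun C hC => by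
    rw [← hLcyl C hC]
    exact (c.measure_eq_content_of_regular hreg ⟨C, hC.isCompact⟩).trans (hc _)
  -- The restrictions to the compact sets `leastEq t` are finite and inner regular, hence so is
  -- their sum inner regular; on compact sets it still equals `ρ`.
  let μ := Measure.sum fun t => ρ.restrict (leastEq t)
  have hμ : ∀ K, IsCompact K → μ K = ρ K := fun K hK => by
    rw [measure_eq_tsum_leastEq ρ hK, Measure.sum_apply _ hK.measurableSet]
    simp_rw [Measure.restrict_apply hK.measurableSet]
  have : ∀ t, IsFiniteMeasure (ρ.restrict (leastEq (T := T) t)) := fun t =>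
    isFiniteMeasure_restrict.2 (isCompact_leastEq t).measure_lt_top.ne
  refine ⟨μ, ⟨fun K hK => ?_⟩, inferInstance, fun C hC => ?_⟩
  · rw [hμ K hK]; exact hK.measure_lt_top
  · rw [hμ C hC.isCompact, hρ C hC]

theorem isPiSystem_compl_hit :
    IsPiSystem (Set.range fun A : Finset T => (hit A)ᶜ) := by
  classical
  rintro _ ⟨A, rfl⟩ _ ⟨B, rfl⟩ _
  exact ⟨A ∪ B, by simp only [hit_union, Set.compl_union]⟩

/-- Inside a finite window `hit A`, the complements of hitting sets form a generating π-system whose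
masses are differences of masses of hitting sets. -/
theorem measure_isCylinder_eq {μ μ' : Measure (PowerSpace.Nonempty T)}
    [IsFiniteMeasureOnCompacts μ] [IsFiniteMeasureOnCompacts μ']
    (h : ∀ A, μ (hit A) = μ' (hit A)) {C : Set (PowerSpace.Nonempty T)} (hC : IsCylinder C) :
    μ C = μ' C := by
  classical
  obtain ⟨A, hA⟩ := exists_subset_hit hC.isCompact
  have hf : ∀ (μ : Measure (PowerSpace.Nonempty T)) [IsFiniteMeasureOnCompacts μ] (A : Finset T),
      μ (hit A) ≠ ∞ := fun μ _ A => (isCompact_hit A).measure_lt_top.ne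
  have : IsFiniteMeasure (μ.restrict (hit A)) := isFiniteMeasure_restrict.2 (hf μ A)
  have key : ∀ (μ : Measure (PowerSpace.Nonempty T)) [IsFiniteMeasureOnCompacts μ] (B : Finset T),
      μ.restrict (hit A) (hit B)ᶜ = μ (hit (A ∪ B)) - μ (hit B) := by
    intro μ _ B
    rw [Measure.restrict_apply (measurableSet_hit B).compl,
      ← measure_sdiff (by rw [hit_union]; exact Set.subset_union_right)
        (measurableSet_hit B).nullMeasurableSet (hf μ B)]
    congr 1
    ext Q
    simp only [hit_union, Set.mem_inter_iff, Set.mem_compl_iff, Set.mem_sdiff, Set.mem_union]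
    tauto
  have h1 := ext_on_measurableSpace_of_generate_finite (m₀ := Subtype.instMeasurableSpace)
    (μ := μ.restrict (hit A)) (ν := μ'.restrict (hit A)) (m := cylinderSigma T)
    (Set.range fun A : Finset T => (hit A)ᶜ) ?_ cylinderSigma_le rfl isPiSystem_compl_hit ?_
    hC.measurableSet
  · rwa [Measure.restrict_apply hC.isOpen.measurableSet,
      Measure.restrict_apply hC.isOpen.measurableSet, Set.inter_eq_left.2 hA] at h1
  · rintro _ ⟨B, rfl⟩
    rw [key μ, key μ', h, h]
  · rw [Measure.restrict_apply_univ, Measure.restrict_apply_univ, h]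

/-- A cylinder fits between a compact set and an open set of nearly the same mass, so agreement on
cylinders gives agreement on compact sets, and inner regularity does the rest. -/
theorem eq_of_measure_hit_eq {μ μ' : Measure (PowerSpace.Nonempty T)}
    [IsFiniteMeasureOnCompacts μ] [IsFiniteMeasureOnCompacts μ'] [μ.InnerRegular]
    [μ'.InnerRegular] (h : ∀ A, μ (hit A) = μ' (hit A)) : μ = μ' := by
  have hle : ∀ (μ μ' : Measure (PowerSpace.Nonempty T)) [IsFiniteMeasureOnCompacts μ]
      [IsFiniteMeasureOnCompacts μ'] [μ'.InnerRegular], (∀ A, μ (hit A) = μ' (hit A)) →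
      ∀ K, IsCompact K → μ K ≤ μ' K := by
    intro μ μ' _ _ _ h K hK
    refine le_of_forall_gt fun r hr => ?_
    obtain ⟨U, hKU, hU, hlt⟩ := hK.exists_isOpen_lt_of_lt r hr
    obtain ⟨C, hC, hKC, hCU⟩ := exists_isCylinder_between hK hU hKU
    calc μ K ≤ μ C := measure_mono hKC
      _ = μ' C := measure_isCylinder_eq h hC
      _ ≤ μ' U := measure_mono hCU
      _ < r := hlt
  have heq : ∀ K, IsCompact K → μ K = μ' K := fun K hK =>
    le_antisymm (hle μ μ' h K hK) (hle μ' μ (fun A => (h A).symm) K hK)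
  ext B hB
  rw [hB.measure_eq_iSup_isCompact, hB.measure_eq_iSup_isCompact]
  exact iSup_congr fun K => iSup_congr fun _ => iSup_congr fun hK => heq K hK

/-! ### Vague limits of rescaled random sets -/

/-- Only the events `t ∈ Q ω` are assumed measurable, which is weaker than Borel measurability of
`Q` but enough for cylinders. -/
theorem measurableSet_mem_cylinder {Ω : Type*} [MeasurableSpace Ω] {Q : Ω → PowerSpace T}
    (hQ : ∀ t, MeasurableSet {ω | t ∈ Q ω}) {C : Set (PowerSpace.Nonempty T)}
    (hC : IsCylinder C) : MeasurableSet {ω | ∃ R ∈ C, R.1 = Q ω} := by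
  obtain ⟨A, hA⟩ := exists_subset_hit hC.isCompact
  have hhit : ∀ B : Finset T, MeasurableSet {ω | ∃ t ∈ B, t ∈ Q ω} := fun B => by
    have : {ω | ∃ t ∈ B, t ∈ Q ω} = ⋃ t ∈ B, {ω | t ∈ Q ω} := by ext; simp
    rw [this]
    exact B.measurableSet_biUnion fun t _ => hQ t
  -- Intersecting with `hit A` guarantees that `Q ω` is non-empty, so complementing `D` becomes a
  -- difference of events.
  have key : ∀ D, MeasurableSet[cylinderSigma T] D →
      MeasurableSet {ω | ∃ R ∈ D ∩ hit A, R.1 = Q ω} := by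
    intro D hD
    induction D, hD using MeasurableSpace.generateFrom_induction with
    | hC D hD _ =>
      obtain ⟨B, rfl⟩ := hD
      convert (hhit A).diff (hhit B) using 1
      ext ω
      simp only [Set.mem_ofPred_eq, Set.mem_sdiff]
      constructor
      · rintro ⟨R, ⟨h1, h2⟩, h3⟩
        rw [← h3]
        exact ⟨h2, h1⟩
      · rintro ⟨h1, h2⟩
        obtain ⟨t, ht, htQ⟩ := h1
        exact ⟨⟨Q ω, t, htQ⟩, ⟨h2, t, ht, htQ⟩, rfl⟩
    | empty => simp
    | compl D _ ih =>
      convert (hhit A).diff ih using 1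
      ext ω
      simp only [Set.mem_ofPred_eq, Set.mem_sdiff]
      constructor
      · rintro ⟨R, ⟨h1, h2⟩, h3⟩
        refine ⟨by rw [← h3]; exact h2, ?_⟩
        rintro ⟨R', ⟨h1', _⟩, h3'⟩
        have : R = R' := Subtype.ext (h3.trans h3'.symm)
        exact h1 (this ▸ h1')
      · rintro ⟨⟨t, ht, htQ⟩, h2⟩
        exact ⟨⟨Q ω, t, htQ⟩, ⟨fun h => h2 ⟨_, ⟨h, t, ht, htQ⟩, rfl⟩, t, ht, htQ⟩, rfl⟩
    | iUnion f _ ih =>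
      convert MeasurableSet.iUnion ih using 1
      ext ω
      simp only [Set.mem_ofPred_eq, Set.mem_iUnion, Set.iUnion_inter]
      exact ⟨fun ⟨R, ⟨n, hn⟩, h⟩ => ⟨n, R, hn, h⟩, fun ⟨n, R, hn, h⟩ => ⟨R, ⟨n, hn⟩, h⟩⟩
  have := key C hC.measurableSet
  rwa [Set.inter_eq_left.2 hA] at this

/-- If the rescaled hitting probabilities of a sequence of random sets converge, then their limits
are the hitting masses of a Radon measure. -/
theorem exists_radon_of_tendsto_hit {Ω : Type*} [MeasurableSpace Ω] (P : Measure Ω)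
    {Q : ℕ → Ω → PowerSpace T} (hQ : ∀ n t, MeasurableSet {ω | t ∈ Q n ω}) {θ : Finset T → ℝ≥0∞}
    (hθ : ∀ A, θ A ≠ ∞)
    (h : ∀ A : Finset T, Tendsto (fun n : ℕ => (n : ℝ≥0∞) * P {ω | ∃ t ∈ A, t ∈ Q n ω}) atTop
      (𝓝 (θ A))) :
    ∃ μ : Measure (PowerSpace.Nonempty T), IsFiniteMeasureOnCompacts μ ∧ μ.InnerRegular ∧
      ∀ A, μ (hit A) = θ A := by
  -- By compactness of `ℝ≥0∞`, limits along an ultrafilter exist for all sets `C` simultaneously; on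
  -- hitting sets they equal the given limits.
  let 𝒰 : Ultrafilter ℕ := Ultrafilter.of atTop
  let E : ℕ → Set (PowerSpace.Nonempty T) → Set Ω := fun n C => {ω | ∃ R ∈ C, R.1 = Q n ω}
  let a : Set (PowerSpace.Nonempty T) → ℕ → ℝ≥0∞ := fun C n => n * P (E n C)
  let l : Set (PowerSpace.Nonempty T) → ℝ≥0∞ := fun C => (𝒰.map (a C)).lim
  have hl : ∀ C, Tendsto (a C) 𝒰 (𝓝 (l C)) := fun C => (𝒰.map (a C)).le_nhds_lim
  have hhit : ∀ A, l (hit A) = θ A := by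
    intro A
    refine tendsto_nhds_unique (hl (hit A)) (((h A).mono_left (Ultrafilter.of_le _)).congr
      fun n => ?_)
    have : E n (hit A) = {ω | ∃ t ∈ A, t ∈ Q n ω} := by
      ext ω
      constructor
      · rintro ⟨R, hR, h⟩
        change ∃ t ∈ A, t ∈ Q n ω
        rw [← h]; exact hR
      · rintro ⟨t, ht, htQ⟩
        exact ⟨⟨Q n ω, t, htQ⟩, ⟨t, ht, htQ⟩, rfl⟩
    simp only [a, this]
  have hmono : ∀ C D, C ⊆ D → l C ≤ l D := fun C D hCD =>
    le_of_tendsto_of_tendsto' (hl C) (hl D) fun n => by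
      refine mul_le_mul_right (measure_mono ?_) _
      rintro ω ⟨R, hR, h⟩
      exact ⟨R, hCD hR, h⟩
  have hEu : ∀ n C D, E n (C ∪ D) = E n C ∪ E n D := by
    intro n C D
    ext ω
    simp only [E, Set.mem_ofPred_eq, Set.mem_union]
    exact ⟨fun ⟨R, hR, h⟩ => hR.imp (fun hR => ⟨R, hR, h⟩) fun hR => ⟨R, hR, h⟩,
      fun h => h.elim (fun ⟨R, hR, h⟩ => ⟨R, Or.inl hR, h⟩) fun ⟨R, hR, h⟩ => ⟨R, Or.inr hR, h⟩⟩
  have hunion : ∀ C D, l (C ∪ D) ≤ l C + l D := by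
    intro C D
    refine le_of_tendsto_of_tendsto' (hl _) ((hl C).add (hl D)) fun n => ?_
    simp only [a]
    rw [← mul_add, hEu]
    exact mul_le_mul_right (measure_union_le _ _) _
  have hdisj : ∀ C D, IsCylinder C → IsCylinder D → Disjoint C D → l C + l D ≤ l (C ∪ D) := by
    intro C D hC hD hd
    refine le_of_tendsto_of_tendsto' ((hl C).add (hl D)) (hl _) fun n => ?_
    simp only [a]
    rw [← mul_add, hEu, measure_union _ (measurableSet_mem_cylinder (hQ n) hD)]
    refine Set.disjoint_left.2 ?_
    rintro ω ⟨R, hR, h⟩ ⟨R', hR', h'⟩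
    have : R = R' := Subtype.ext (h.trans h'.symm)
    exact Set.disjoint_left.1 hd hR (this ▸ hR')
  have hfin : ∀ C, IsCylinder C → l C ≠ ∞ := by
    intro C hC
    obtain ⟨A, hA⟩ := exists_subset_hit hC.isCompact
    exact ne_top_of_le_ne_top (hhit A ▸ hθ A) (hmono _ _ hA)
  obtain ⟨μ, h1, h2, h3⟩ := exists_radon_of_cylinder l hmono hunion hdisj hfin
  exact ⟨μ, h1, h2, fun A => (h3 _ (isCylinder_hit A)).trans (hhit A)⟩

end PowerSpace

/-! ### The measure representing an extremal coefficient function -/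

/-- If `n (-log p n) → a`, then `n (1 - p n) → a`. -/
theorem tendsto_mul_one_sub_of_log {p : ℕ → ℝ} {a : ℝ} (hp1 : ∀ n, p n ≤ 1)
    (hp : Tendsto p atTop (𝓝 1)) (h : Tendsto (fun n : ℕ => (n : ℝ) * -Real.log (p n)) atTop (𝓝 a)) :
    Tendsto (fun n : ℕ => (n : ℝ) * (1 - p n)) atTop (𝓝 a) := by
  have hlog : Tendsto (fun n => -Real.log (p n)) atTop (𝓝 0) := by
    simpa using (hp.log one_ne_zero).neg
  -- The second-order error of the logarithm is at most `n (log p)²`, a convergent factor times a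
  -- vanishing one.
  have h0 : Tendsto (fun n : ℕ => ((n : ℝ) * -Real.log (p n)) * -Real.log (p n)) atTop (𝓝 0) := by
    simpa using h.mul hlog
  have hdiff : Tendsto (fun n : ℕ => (n : ℝ) * -Real.log (p n) - n * (1 - p n)) atTop (𝓝 0) := by
    refine squeeze_zero_norm' ?_ h0
    filter_upwards [hp.eventually (lt_mem_nhds zero_lt_one),
      hlog.eventually (gt_mem_nhds zero_lt_one)] with n hpos hlt
    have hnn : 0 ≤ -Real.log (p n) := by
      have := Real.log_nonpos hpos.le (hp1 n)
      linarith
    have hb := Real.abs_exp_sub_one_sub_id_le (x := Real.log (p n))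
      (by rw [← abs_neg, abs_of_nonneg hnn]; exact hlt.le)
    rw [Real.exp_log hpos] at hb
    rw [← mul_sub, norm_mul, Real.norm_natCast, Real.norm_eq_abs, mul_assoc]
    refine mul_le_mul_of_nonneg_left ?_ (Nat.cast_nonneg n)
    calc |-Real.log (p n) - (1 - p n)| = |p n - 1 - Real.log (p n)| := by ring_nf
      _ ≤ Real.log (p n) ^ 2 := hb
      _ = -Real.log (p n) * -Real.log (p n) := by ring
  simpa using h.sub hdiff

section ExtremalCoefficient

variable {T Ω : Type*} [MeasurableSpace Ω] {X : T → Ω → ℝ} {P : Measure Ω} [IsProbabilityMeasure P]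
  {θ : Finset T → ℝ}

theorem IsSimpleMaxStable.real_le (hX : IsSimpleMaxStable X P) (t : T) {x : ℝ} (hx : 0 < x) :
    P.real {ω | X t ω ≤ x} = Real.exp (-(1 / x)) := by
  rw [Measure.real, hX.frechet t x hx, ENNReal.toReal_ofReal (Real.exp_pos _).le]

theorem IsSimpleMaxStable.tendsto_real_le (hX : IsSimpleMaxStable X P) (A : Finset T) :
    Tendsto (fun n : ℕ => P.real {ω | ∀ t ∈ A, X t ω ≤ n}) atTop (𝓝 1) := by
  have hmeas : ∀ (n : ℕ) t, MeasurableSet {ω | X t ω ≤ n} := fun n t =>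
    measurableSet_le (hX.measurable t) measurable_const
  have hone : Tendsto (fun n : ℕ => 1 - ∑ _t ∈ A, (1 - Real.exp (-(1 / (n : ℝ))))) atTop (𝓝 1) := by
    have h1 : Tendsto (fun n : ℕ => Real.exp (-(1 / (n : ℝ)))) atTop (𝓝 1) := by
      simpa [Function.comp_def] using (Real.continuous_exp.tendsto _).comp tendsto_one_div_atTop_nhds_zero_nat.neg
    simpa using (tendsto_finsetSum A fun _ _ => h1.const_sub 1).const_sub 1
  refine tendsto_of_tendsto_of_tendsto_of_le_of_le' hone tendsto_const_nhds ?_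
    (Eventually.of_forall fun n => measureReal_le_one)
  filter_upwards [eventually_gt_atTop 0] with n hn
  have hc : P.real {ω | ∀ t ∈ A, X t ω ≤ n}ᶜ ≤ ∑ t ∈ A, (1 - Real.exp (-(1 / (n : ℝ)))) := by
    have : {ω | ∀ t ∈ A, X t ω ≤ n}ᶜ = ⋃ t ∈ A, {ω | X t ω ≤ n}ᶜ := by
      ext ω; simp
    rw [this]
    refine (measureReal_biUnion_finset_le A _).trans (Finset.sum_le_sum fun t _ => ?_)
    rw [probReal_compl_eq_one_sub (hmeas n t), hX.real_le t (by exact_mod_cast hn)]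
  have hmA : MeasurableSet {ω | ∀ t ∈ A, X t ω ≤ n} := by
    have : {ω | ∀ t ∈ A, X t ω ≤ n} = ⋂ t ∈ A, {ω | X t ω ≤ n} := by ext ω; simp
    rw [this]
    exact A.measurableSet_biInter fun t _ => hmeas n t
  rw [probReal_compl_eq_one_sub hmA] at hc
  linarith

theorem IsECFOf.tendsto_mul (hX : IsSimpleMaxStable X P) (hθ : IsECFOf θ X P) (A : Finset T) :
    Tendsto (fun n : ℕ => (n : ℝ) * (1 - P.real {ω | ∀ t ∈ A, X t ω ≤ n})) atTop (𝓝 (θ A)) := by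
  rcases A.eq_empty_or_nonempty with rfl | hA
  · simp [hθ.1]
  · obtain ⟨s, hs⟩ := hA
    refine tendsto_mul_one_sub_of_log (fun n => measureReal_le_one) (hX.tendsto_real_le A) ?_
    refine ((hθ.2 A ⟨s, hs⟩ s).comp tendsto_natCast_atTop_atTop).congr' ?_
    filter_upwards [eventually_gt_atTop 0] with n hn
    simp only [Function.comp_apply]
    rw [hX.real_le s (by exact_mod_cast hn), Real.log_exp]
    have : (n : ℝ) ≠ 0 := by exact_mod_cast hn.ne'
    field_simp

theorem IsECFOf.nonneg (hX : IsSimpleMaxStable X P) (hθ : IsECFOf θ X P) (A : Finset T) :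
    0 ≤ θ A :=
  ge_of_tendsto' (hθ.tendsto_mul hX A) fun n =>
    mul_nonneg (Nat.cast_nonneg n) (sub_nonneg.2 measureReal_le_one)

theorem IsECFOf.singleton (hX : IsSimpleMaxStable X P) (hθ : IsECFOf θ X P) (t : T) :
    θ {t} = 1 := by
  refine tendsto_nhds_unique (hθ.2 {t} (Finset.singleton_nonempty t) t)
    (tendsto_const_nhds.congr' ?_)
  filter_upwards [eventually_gt_atTop 0] with x hx
  simp only [Finset.mem_singleton, forall_eq]
  rw [hX.real_le t hx, Real.log_exp, div_self]
  exact (neg_neg_of_pos (one_div_pos.2 hx)).ne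

/-- The measure is the vague limit of the scaled laws of the exceedance sets `{t | n < X t}`. -/
theorem IsECFOf.exists_isIntegralRepresentation (hX : IsSimpleMaxStable X P)
    (hθ : IsECFOf θ X P) :
    ∃ μ : Measure (PowerSpace.Nonempty T), IsIntegralRepresentation θ μ := by
  let Q : ℕ → Ω → PowerSpace T := fun n ω => ({t | (n : ℝ) < X t ω} : Set T)
  have hmem : ∀ n ω t, t ∈ Q n ω ↔ (n : ℝ) < X t ω := fun n ω t => Iff.rfl
  have hQ : ∀ n t, MeasurableSet {ω | t ∈ Q n ω} := fun n t =>
    measurableSet_lt measurable_const (hX.measurable t)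
  obtain ⟨μ, h1, h2, h3⟩ := PowerSpace.exists_radon_of_tendsto_hit P hQ
    (θ := fun A => ENNReal.ofReal (θ A)) (fun A => ENNReal.ofReal_ne_top) fun A => by
      refine (ENNReal.tendsto_ofReal (hθ.tendsto_mul hX A)).congr fun n => ?_
      have hm : MeasurableSet {ω | ∃ t ∈ A, t ∈ Q n ω} := by
        have : {ω | ∃ t ∈ A, t ∈ Q n ω} = ⋃ t ∈ A, {ω | t ∈ Q n ω} := by ext; simp
        rw [this]
        exact A.measurableSet_biUnion fun t _ => hQ n t
      have hc : {ω | ∀ t ∈ A, X t ω ≤ n} = {ω | ∃ t ∈ A, t ∈ Q n ω}ᶜ := by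
        ext ω; simp [hmem]
      rw [hc, probReal_compl_eq_one_sub hm, sub_sub_cancel,
        ENNReal.ofReal_mul (Nat.cast_nonneg n), ENNReal.ofReal_natCast, ofReal_measureReal]
  exact ⟨μ, h1, h2, fun A => (PowerSpace.isCompact_hit A).measure_lt_top.ne, fun A => by
    rw [show {Q : PowerSpace.Nonempty T | ∃ t ∈ A, t ∈ Q.1} = PowerSpace.hit A from rfl, h3,
      ENNReal.toReal_ofReal (hθ.nonneg hX A)]⟩

end ExtremalCoefficient

theorem IsIntegralRepresentation.unique {T : Type*} {θ : Finset T → ℝ}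
    {μ μ' : Measure (PowerSpace.Nonempty T)} (h : IsIntegralRepresentation θ μ)
    (h' : IsIntegralRepresentation θ μ') : μ = μ' := by
  have := h.finite_on_compacts
  have := h'.finite_on_compacts
  have := h.inner_regular
  have := h'.inner_regular
  refine PowerSpace.eq_of_measure_hit_eq fun A => ?_
  refine (ENNReal.toReal_eq_toReal_iff' (h.measure_hit_ne_top A) (h'.measure_hit_ne_top A)).1 ?_
  exact (h.measure_hit A).symm.trans (h'.measure_hit A)

/-! ### The coefficients of the Tawn–Molchanov process -/

namespace PowerSpace

variable {T : Type*}

/-- The non-empty sets `Q` with `Q ∩ M = L`, for `L ⊆ M`. -/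
def trace (M L : Finset T) : Set (PowerSpace.Nonempty T) := {Q | ∀ t ∈ M, t ∈ Q.1 ↔ t ∈ L}

theorem measurableSet_trace (M L : Finset T) : MeasurableSet (trace M L) := by
  have : trace M L = ⋂ t ∈ M, {Q : PowerSpace.Nonempty T | t ∈ Q.1 ↔ t ∈ L} := by
    ext Q; simp [trace]
  rw [this]
  refine M.measurableSet_biInter fun t _ => ?_
  by_cases ht : t ∈ L
  · simpa [ht] using (isClopen_mem_val t).isOpen.measurableSet
  · simp only [ht, iff_false]
    exact (isClopen_mem_val t).isOpen.measurableSet.compl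

-- With `a` the indicator that `Q` misses `M \ L`, the hitting indicator is `1 - a ∏ (1 - q i)` over
-- `I`. The alternating sum kills the constant because `L` is non-empty, and the product expansion
-- leaves `a ∏ q i` over `L`.
open Classical in
theorem sum_indicator_hit {M L : Finset T} (hL : L.Nonempty) (hLM : L ⊆ M)
    (Q : PowerSpace.Nonempty T) :
    ∑ I ∈ L.powerset, (-1 : ℝ) ^ (I.card + 1) * (hit ((M \ L) ∪ I)).indicator 1 Q =
      (trace M L).indicator 1 Q := by
  let q : T → ℝ := fun t => if t ∈ Q.1 then 1 else 0
  let a : ℝ := if Q ∈ hit (M \ L) then 0 else 1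
  have h1 : ∀ I : Finset T, (hit ((M \ L) ∪ I)).indicator (1 : PowerSpace.Nonempty T → ℝ) Q =
      1 - a * ∏ i ∈ I, (1 - q i) := by
    intro I
    by_cases hI : ∃ i ∈ I, i ∈ Q.1
    · obtain ⟨i, hi, hiQ⟩ := hI
      rw [Finset.prod_eq_zero hi (by simp [q, hiQ]), mul_zero, sub_zero,
        Set.indicator_of_mem]
      · rfl
      · exact ⟨i, Finset.mem_union_right _ hi, hiQ⟩
    · push Not at hI
      rw [Finset.prod_eq_one fun i hi => by simp [q, hI i hi]]
      have : Q ∈ hit (M \ L ∪ I) ↔ Q ∈ hit (M \ L) := by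
        rw [hit_union]
        exact or_iff_left fun ⟨i, hi, hiQ⟩ => hI i hi hiQ
      by_cases h : Q ∈ hit (M \ L) <;> simp [a, h, this]
  have h2 : ∀ f : T → ℝ, ∑ I ∈ L.powerset, (-1 : ℝ) ^ I.card * ∏ i ∈ I, f i =
      ∏ i ∈ L, (1 - f i) := by
    intro f
    simp_rw [sub_eq_add_neg, Finset.prod_one_add]
    refine Finset.sum_congr rfl fun I _ => ?_
    rw [Finset.prod_neg]
  have h3 := h2 fun _ => 1
  have h4 := h2 fun i => 1 - q i
  obtain ⟨i₀, hi₀⟩ := hL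
  rw [Finset.prod_eq_zero hi₀ (by simp)] at h3
  simp only [Finset.prod_const_one, mul_one, sub_sub_cancel] at h3 h4
  have h5 : ∑ I ∈ L.powerset, (-1 : ℝ) ^ (I.card + 1) * (hit ((M \ L) ∪ I)).indicator 1 Q =
      -∑ I ∈ L.powerset, (-1 : ℝ) ^ I.card +
        a * ∑ I ∈ L.powerset, (-1 : ℝ) ^ I.card * ∏ i ∈ I, (1 - q i) := by
    rw [Finset.mul_sum, ← Finset.sum_neg_distrib, ← Finset.sum_add_distrib]
    refine Finset.sum_congr rfl fun I _ => ?_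
    rw [h1, pow_succ]
    ring
  rw [h5, h3, h4, neg_zero, zero_add]
  by_cases hQ : Q ∈ trace M L
  · rw [Set.indicator_of_mem hQ, Finset.prod_eq_one fun i hi => by
      simp [q, (hQ i (hLM hi)).2 hi]]
    have : Q ∉ hit (M \ L) := fun ⟨t, ht, htQ⟩ =>
      (Finset.mem_sdiff.1 ht).2 ((hQ t (Finset.mem_sdiff.1 ht).1).1 htQ)
    simp [a, this]
  · rw [Set.indicator_of_notMem hQ]
    by_cases h : Q ∈ hit (M \ L)
    · simp [a, h]
    · have : ∃ i ∈ L, i ∉ Q.1 := by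
        by_contra! hcon
        refine hQ fun t ht => ⟨fun htQ => ?_, hcon t⟩
        by_contra htL
        exact h ⟨t, Finset.mem_sdiff.2 ⟨ht, htL⟩, htQ⟩
      obtain ⟨i, hi, hiQ⟩ := this
      rw [Finset.prod_eq_zero hi (by simp [q, hiQ]), mul_zero]

end PowerSpace

theorem IsIntegralRepresentation.tauCoeff_eq {T : Type*} {θ : Finset T → ℝ}
    {μ : Measure (PowerSpace.Nonempty T)} (h : IsIntegralRepresentation θ μ) {M L : Finset T}
    (hL : L.Nonempty) (hLM : L ⊆ M) : tauCoeff θ M L = μ.real (PowerSpace.trace M L) := by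
  classical
  have hint : ∀ A : Finset T,
      Integrable ((PowerSpace.hit A).indicator (1 : PowerSpace.Nonempty T → ℝ)) μ := fun A =>
    (integrable_indicator_iff (PowerSpace.measurableSet_hit A)).2
      (integrableOn_const (h.measure_hit_ne_top A))
  rw [← integral_indicator_one (PowerSpace.measurableSet_trace M L)]
  rw [integral_congr_ae (ae_of_all _ fun Q =>
    (PowerSpace.sum_indicator_hit hL hLM Q).symm),
    integral_finsetSum _ fun I _ => (hint _).const_mul _]
  unfold tauCoeff
  refine Finset.sum_congr (by congr) fun I _ => ?_
  rw [integral_const_mul, integral_indicator_one (PowerSpace.measurableSet_hit _)]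
  congr 1
  rw [h.measure_hit]
  unfold Measure.real PowerSpace.hit
  congr!

/-! ### The intensity measure -/

theorem NNReal.measurableEmbedding_toReal : MeasurableEmbedding ((↑) : ℝ≥0 → ℝ) :=
  MeasurableEmbedding.subtype_coe measurableSet_Ici

instance : SFinite invSqMeasure := by
  have he := NNReal.measurableEmbedding_toReal
  have : SigmaFinite ((volume : Measure ℝ).comap ((↑) : ℝ≥0 → ℝ)) := by
    refine SigmaFinite.of_map _ he.measurable.aemeasurable ?_
    rw [he.map_comap]
    infer_instance
  unfold invSqMeasure
  infer_instance

theorem invSqMeasure_setOf_lt {x : ℝ} (hx : 0 < x) :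
    invSqMeasure {u : ℝ≥0 | x < u} = ENNReal.ofReal (1 / x) := by
  have hm : MeasurableSet {u : ℝ≥0 | x < u} :=
    measurableSet_lt measurable_const measurable_coe_nnreal_real
  have he := NNReal.measurableEmbedding_toReal
  have h1 : ∀ u ∈ {u : ℝ≥0 | x < u}, ((u : ℝ≥0∞) ^ 2)⁻¹ = ENNReal.ofReal ((u : ℝ) ^ (-2 : ℝ)) := by
    intro u hu
    have hu0 : (0 : ℝ) < u := hx.trans hu
    rw [Real.rpow_neg hu0.le, ENNReal.ofReal_inv_of_pos (by positivity)]
    congr 1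
    rw [Real.rpow_two, ENNReal.ofReal_pow hu0.le, ENNReal.ofReal_coe_nnreal]
  have hpre : {u : ℝ≥0 | x < u} = ((↑) : ℝ≥0 → ℝ) ⁻¹' Set.Ioi x := rfl
  rw [invSqMeasure, withDensity_apply _ hm, setLIntegral_congr_fun hm h1, hpre,
    ← setLIntegral_map measurableSet_Ioi (f := fun y => ENNReal.ofReal (y ^ (-2 : ℝ)))
      (by fun_prop) he.measurable, he.map_comap, Measure.restrict_restrict measurableSet_Ioi]
  have hr : Set.Ioi x ∩ Set.range ((↑) : ℝ≥0 → ℝ) = Set.Ioi x :=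
    Set.inter_eq_left.2 fun y hy => ⟨⟨y, (hx.trans hy).le⟩, rfl⟩
  rw [hr, ← ofReal_integral_eq_lintegral_ofReal
    (integrableOn_Ioi_rpow_of_lt (by norm_num) hx)]
  · rw [integral_Ioi_rpow_of_lt (by norm_num) hx]
    norm_num [Real.rpow_neg_one]
  · filter_upwards [ae_restrict_mem measurableSet_Ioi] with y hy
    exact Real.rpow_nonneg (hx.trans hy).le _

/-- This includes `u = 0`, where the density is infinite but Lebesgue measure has no atom. Having no
atoms also keeps sampled Poisson points distinct. -/
theorem invSqMeasure_singleton (u : ℝ≥0) : invSqMeasure {u} = 0 := by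
  refine withDensity_absolutelyContinuous _ _ ?_
  rw [NNReal.measurableEmbedding_toReal.comap_apply]
  simp

/-- A partition of `(0, ∞)` into countably many sets of finite `invSqMeasure`. -/
def invSqPart : ℕ → Set ℝ≥0 := disjointed fun n => {u : ℝ≥0 | (1 / ((n : ℝ) + 1)) < u}

theorem measurableSet_invSqPart (n : ℕ) : MeasurableSet (invSqPart n) :=
  MeasurableSet.disjointed (fun _ => measurableSet_lt measurable_const measurable_coe_nnreal_real) n

theorem sum_restrict_invSqPart :
    Measure.sum (fun n => invSqMeasure.restrict (invSqPart n)) = invSqMeasure := by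
  rw [← Measure.restrict_iUnion (s := invSqPart) (disjoint_disjointed _) measurableSet_invSqPart]
  have h : ⋃ n, invSqPart n = {0}ᶜ := by
    rw [invSqPart, iUnion_disjointed]
    ext u
    simp only [Set.mem_iUnion, Set.mem_ofPred_eq, Set.mem_compl_iff, Set.mem_singleton_iff]
    constructor
    · rintro ⟨n, hn⟩ rfl
      have : (0 : ℝ) < 1 / (n + 1) := Nat.one_div_pos_of_nat
      exact absurd hn (by simpa using this.le)
    · intro hu
      exact exists_nat_one_div_lt (NNReal.coe_pos.2 (pos_iff_ne_zero.2 hu))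
  rw [h]
  exact Measure.restrict_eq_self_of_ae_mem (measure_eq_zero_iff_ae_notMem.1
    (invSqMeasure_singleton 0))

instance (n : ℕ) : IsFiniteMeasure (invSqMeasure.restrict (invSqPart n)) := by
  refine isFiniteMeasure_restrict.2 (ne_top_of_le_ne_top ?_
    (measure_mono (disjointed_subset _ n)))
  rw [invSqMeasure_setOf_lt Nat.one_div_pos_of_nat]
  exact ENNReal.ofReal_ne_top

/-- The intensity measure of the Poisson point process belonging to a Radon measure on the
non-empty subsets is the intensity of a Poisson point process. -/
theorem exists_isPoissonPointProcess_spectralIntensity {T : Type u}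
    (μ : Measure (PowerSpace.Nonempty T)) [IsFiniteMeasureOnCompacts μ] [μ.InnerRegular] :
    ∃ (Ω : Type u) (_ : MeasurableSpace Ω) (P : Measure Ω) (Pi : Ω → Set (ℝ≥0 × PowerSpace T)),
      IsProbabilityMeasure P ∧ IsPoissonPointProcess Pi P (spectralIntensity
        (μ.map (Subtype.val : PowerSpace.Nonempty T → PowerSpace T))) := by
  let ν : T → Measure (PowerSpace T) :=
    fun t => (μ.restrict (PowerSpace.leastEq t)).map Subtype.val
  have hν : ∀ t, IsFiniteMeasure (ν t) := fun t => by
    have : IsFiniteMeasure (μ.restrict (PowerSpace.leastEq t)) :=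
      isFiniteMeasure_restrict.2 (PowerSpace.isCompact_leastEq t).measure_lt_top.ne
    exact Measure.isFiniteMeasure_map _ _
  -- The pieces are indexed by the least element of `Q` and a level of `u`; both factors are finite,
  -- and the supports are disjoint.
  let m : T × ℕ → Measure (ℝ≥0 × PowerSpace T) :=
    fun p => ((ν p.1).prod (invSqMeasure.restrict (invSqPart p.2))).map Prod.swap
  have hm : ∀ p, IsFiniteMeasure (m p) := fun p => Measure.isFiniteMeasure_map _ _
  have hsum : spectralIntensity (μ.map (Subtype.val : PowerSpace.Nonempty T → PowerSpace T)) =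
      Measure.sum m := by
    have h1 : μ.map (Subtype.val : PowerSpace.Nonempty T → PowerSpace T) = Measure.sum ν := by
      conv_lhs => rw [← PowerSpace.sum_restrict_leastEq μ]
      exact Measure.map_sum measurable_subtype_coe.aemeasurable
    rw [spectralIntensity, h1]
    conv_lhs => rw [← sum_restrict_invSqPart]
    rw [Measure.prod_sum_left]
    simp_rw [Measure.prod_sum_right]
    rw [Measure.sum_sum, Measure.map_sum measurable_swap.aemeasurable]
  have hemb : MeasurableEmbedding (Subtype.val : PowerSpace.Nonempty T → PowerSpace T) :=
    MeasurableEmbedding.subtype_coe PowerSpace.isOpen_nonempty.measurableSet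
  let S : T × ℕ → Set (ℝ≥0 × PowerSpace T) :=
    fun p => invSqPart p.2 ×ˢ (Subtype.val '' PowerSpace.leastEq p.1)
  have hD : ∀ t : T, MeasurableSet (Subtype.val '' PowerSpace.leastEq t) :=
    fun t => hemb.measurableSet_image.2 (PowerSpace.measurableSet_leastEq t)
  have hS : ∀ p, MeasurableSet (S p) := fun p => (measurableSet_invSqPart p.2).prod (hD p.1)
  rw [hsum]
  refine exists_isPoissonPointProcess_sum m measurable_fst (fun p u => ?_) hS ?_ fun p => ?_
  · rw [Measure.map_apply measurable_swap (measurable_fst (measurableSet_singleton u))]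
    have : Prod.swap ⁻¹' (Prod.fst ⁻¹' {u} : Set (ℝ≥0 × PowerSpace T)) = Set.univ ×ˢ {u} := by
      ext; simp
    rw [this, Measure.prod_prod, Measure.restrict_apply (measurableSet_singleton u),
      measure_mono_null Set.inter_subset_left (invSqMeasure_singleton u), mul_zero]
  · rintro ⟨s, i⟩ ⟨t, j⟩ hne
    by_cases hst : s = t
    · have hij : i ≠ j := fun h => hne (by rw [hst, h])
      exact Set.Disjoint.set_prod_left (disjoint_disjointed _ hij) _ _
    · exact Set.Disjoint.set_prod_right ((Set.disjoint_image_iff Subtype.val_injective).2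
        (PowerSpace.pairwise_disjoint_leastEq hst)) _ _
  · rw [Measure.map_apply measurable_swap (hS p).compl]
    refine measure_mono_null (t := (Subtype.val '' PowerSpace.leastEq p.1)ᶜ ×ˢ Set.univ ∪
      Set.univ ×ˢ (invSqPart p.2)ᶜ) ?_ (measure_union_null ?_ ?_)
    · rintro ⟨Q, u⟩ h
      simp only [S, Set.mem_preimage, Prod.swap_prod_mk, Set.mem_compl_iff, Set.mem_prod,
        not_and_or] at h
      simp only [Set.mem_union, Set.mem_prod, Set.mem_compl_iff, Set.mem_univ, and_true, true_and]
      exact h.symm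
    · rw [Measure.prod_prod, Measure.map_apply measurable_subtype_coe (hD p.1).compl,
        Set.preimage_compl, Set.preimage_image_eq _ Subtype.val_injective,
        Measure.restrict_apply (PowerSpace.measurableSet_leastEq p.1).compl]
      simp
    · rw [Measure.prod_prod, Measure.restrict_apply (measurableSet_invSqPart p.2).compl]
      simp

/-! ### Void probabilities and finite-dimensional distributions -/

theorem IsPoissonPointProcess.measure_inter_eq_empty {Ω E : Type*} [MeasurableSpace Ω]
    [MeasurableSpace E] {Pi : Ω → Set E} {P : Measure Ω} {m : Measure E}
    (h : IsPoissonPointProcess Pi P m) {B : Set E} (hB : MeasurableSet B) {r : ℝ} (hr : 0 ≤ r)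
    (hm : m B = ENNReal.ofReal r) :
    P {ω | Pi ω ∩ B = ∅} = ENNReal.ofReal (Real.exp (-r)) := by
  have h1 : {ω | Pi ω ∩ B = ∅} = {ω | (Pi ω ∩ B).encard = 0} := by
    ext ω; simp
  rw [h1, (h.hasLaw B hB).measure_eq (p := fun x => x = 0) (by measurability), hm,
    ENNReal.ofReal, extPoisson_coe, Measure.map_apply measurable_from_top (by measurability)]
  have h2 : (Nat.cast ⁻¹' {x : ℕ∞ | x = 0} : Set ℕ) = {0} := by ext; simp
  rw [h2, poissonMeasure_singleton]
  simp [hr]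

theorem IsPoissonPointProcess.nullMeasurableSet {Ω E : Type*} [MeasurableSpace Ω]
    [MeasurableSpace E] {Pi : Ω → Set E} {P : Measure Ω} {m : Measure E}
    (h : IsPoissonPointProcess Pi P m) {B : Set E} (hB : MeasurableSet B) :
    NullMeasurableSet {ω | Pi ω ∩ B = ∅} P := by
  have h1 : {ω | Pi ω ∩ B = ∅} = (fun ω => (Pi ω ∩ B).encard) ⁻¹' {0} := by
    ext ω; simp
  rw [h1]
  exact (h.hasLaw B hB).aemeasurable.nullMeasurable (by measurability)

section Exceedance

variable {T : Type*}

/-- The points `(u, Q)` for which `u 1_{t ∈ Q}` exceeds `x t` for some `t ∈ M`. -/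
def exceedSet (M : Finset T) (x : T → ℝ) : Set (ℝ≥0 × PowerSpace T) :=
  {p | ∃ t ∈ M, x t < p.1 ∧ t ∈ p.2}

theorem measurableSet_exceedSet (M : Finset T) (x : T → ℝ) : MeasurableSet (exceedSet M x) := by
  have : exceedSet M x = ⋃ t ∈ M, {u : ℝ≥0 | x t < u} ×ˢ {Q : PowerSpace T | t ∈ Q} := by
    ext p
    simp only [exceedSet, Set.mem_ofPred_eq, Set.mem_iUnion, Set.mem_prod, exists_prop]
  rw [this]
  exact M.measurableSet_biUnion fun t _ =>
    (measurableSet_lt measurable_const measurable_coe_nnreal_real).prod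
      (PowerSpace.isClopen_mem t).isOpen.measurableSet

theorem inter_exceedSet_eq_empty_iff {Ω : Type*} {Pi : Ω → Set (ℝ≥0 × PowerSpace T)}
    {M : Finset T} {x : T → ℝ} (hx : ∀ t, 0 ≤ x t) {ω : Ω} :
    Pi ω ∩ exceedSet M x = ∅ ↔
      ∀ t ∈ M, poissonMax memIndicator Pi t ω ≤ ENNReal.ofReal (x t) := by
  rw [Set.eq_empty_iff_forall_notMem]
  simp only [poissonMax, iSup_le_iff, ENNReal.ofReal, ENNReal.coe_le_coe]
  constructor
  · intro h t ht p hp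
    by_cases htp : t ∈ p.2
    · have : ¬ x t < p.1 := fun hlt => h p ⟨hp, t, ht, hlt, htp⟩
      simpa [memIndicator, htp, Real.le_toNNReal_iff_coe_le (hx t)] using this
    · simp [memIndicator, htp]
  · rintro h p ⟨hp, t, ht, hlt, htp⟩
    have := h t ht p hp
    simp only [memIndicator, htp, if_true, mul_one,
      Real.le_toNNReal_iff_coe_le (hx t)] at this
    exact absurd hlt this.not_gt

theorem invSqMeasure_exists_lt {L : Finset T} {x : T → ℝ} (hx : ∀ t, 0 < x t) :
    invSqMeasure {u : ℝ≥0 | ∃ t ∈ L, x t < u} = ENNReal.ofReal (⨆ t : L, 1 / x t) := by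
  rcases L.eq_empty_or_nonempty with rfl | hL
  · simp
  · obtain ⟨s, hs, hmin⟩ := L.exists_min_image x hL
    have h1 : {u : ℝ≥0 | ∃ t ∈ L, x t < u} = {u : ℝ≥0 | x s < u} := by
      ext u
      exact ⟨fun ⟨t, ht, h⟩ => (hmin t ht).trans_lt h, fun h => ⟨s, hs, h⟩⟩
    have h2 : ⨆ t : L, 1 / x t = 1 / x s := by
      have : Nonempty L := ⟨⟨s, hs⟩⟩
      refine le_antisymm (ciSup_le fun t => one_div_le_one_div_of_le (hx s) (hmin t t.2)) ?_
      exact le_ciSup (f := fun t : L => 1 / x t) (Set.finite_range _).bddAbove ⟨s, hs⟩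
    rw [h1, h2, invSqMeasure_setOf_lt (hx s)]

-- If `Q ∩ M = L` is non-empty, a point `(u, Q)` exceeds exactly when `u` is above the least `x t`
-- over `L`, a set of mass `max 1 / x t`. Integrating over the traces `L` gives the sum.
open Classical in
theorem IsIntegralRepresentation.spectralIntensity_exceedSet {θ : Finset T → ℝ}
    {μ : Measure (PowerSpace.Nonempty T)} (h : IsIntegralRepresentation θ μ) (M : Finset T)
    {x : T → ℝ} (hx : ∀ t, 0 < x t) :
    spectralIntensity (μ.map (Subtype.val : PowerSpace.Nonempty T → PowerSpace T))
        (exceedSet M x) =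
      ENNReal.ofReal (∑ L ∈ M.powerset with L.Nonempty, tauCoeff θ M L * ⨆ t : L, 1 / x t) := by
  have hB := measurableSet_exceedSet M x
  rw [spectralIntensity, Measure.map_apply measurable_swap hB,
    Measure.prod_apply (measurable_swap hB),
    lintegral_map (measurable_measure_prodMk_left (measurable_swap hB)) measurable_subtype_coe]
  have hsec : ∀ Q : PowerSpace.Nonempty T,
      invSqMeasure (Prod.mk Q.1 ⁻¹' (Prod.swap ⁻¹' exceedSet M x)) =
      ∑ L ∈ M.powerset with L.Nonempty, (PowerSpace.trace M L).indicator
        (fun _ => ENNReal.ofReal (⨆ t : L, 1 / x t)) Q := by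
    intro Q
    let L₀ : Finset T := M.filter fun t => t ∈ Q.1
    have h1 : Prod.mk Q.1 ⁻¹' (Prod.swap ⁻¹' exceedSet M x) =
        {u : ℝ≥0 | ∃ t ∈ L₀, x t < u} := by
      ext u
      simp only [exceedSet, L₀, Set.mem_preimage, Prod.swap_prod_mk, Set.mem_ofPred_eq,
        Finset.mem_filter]
      grind
    have hL₀ : Q ∈ PowerSpace.trace M L₀ := fun t ht => by simp [L₀, ht]
    have huniq : ∀ L ∈ M.powerset, Q ∈ PowerSpace.trace M L → L = L₀ := by
      intro L hL hQ
      rw [Finset.mem_powerset] at hL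
      ext t
      simp only [L₀, Finset.mem_filter]
      exact ⟨fun ht => ⟨hL ht, (hQ t (hL ht)).2 ht⟩, fun ⟨ht, htQ⟩ => (hQ t ht).1 htQ⟩
    rw [h1, invSqMeasure_exists_lt hx]
    by_cases hne : L₀.Nonempty
    · rw [Finset.sum_eq_single L₀, Set.indicator_of_mem hL₀]
      · intro L hL hne
        refine Set.indicator_of_notMem (fun hQ => hne ?_) _
        exact huniq L (Finset.mem_filter.1 hL).1 hQ
      · intro hn
        exact absurd (Finset.mem_filter.2 ⟨Finset.mem_powerset.2 (Finset.filter_subset _ _), hne⟩) hn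
    · rw [Finset.sum_eq_zero]
      · rw [Finset.not_nonempty_iff_eq_empty.1 hne]
        simp
      · intro L hL
        refine Set.indicator_of_notMem (fun hQ => hne ?_) _
        rw [← huniq L (Finset.mem_filter.1 hL).1 hQ]
        exact (Finset.mem_filter.1 hL).2
  simp_rw [hsec]
  rw [lintegral_finsetSum _ fun L _ => measurable_const.indicator
    (PowerSpace.measurableSet_trace M L), ENNReal.ofReal_sum_of_nonneg]
  · refine Finset.sum_congr rfl fun L hL => ?_
    obtain ⟨hLM, hne⟩ := Finset.mem_filter.1 hL
    rw [Finset.mem_powerset] at hLM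
    rw [lintegral_indicator_const (PowerSpace.measurableSet_trace M L),
      h.tauCoeff_eq hne hLM, ENNReal.ofReal_mul measureReal_nonneg, mul_comm, ofReal_measureReal (h := ?_)]
    refine ne_top_of_le_ne_top (h.measure_hit_ne_top M) (measure_mono fun Q hQ => ?_)
    obtain ⟨t, ht⟩ := hne
    exact ⟨t, hLM ht, (hQ t (hLM ht)).2 ht⟩
  · intro L hL
    obtain ⟨hLM, hne⟩ := Finset.mem_filter.1 hL
    rw [h.tauCoeff_eq hne (Finset.mem_powerset.1 hLM)]
    exact mul_nonneg measureReal_nonneg (Real.iSup_nonneg fun t => (one_div_pos.2 (hx t)).le)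

end Exceedance

/-! ### Equality of laws -/

section SameLaw

variable {T Ω Ω' : Type*} [MeasurableSpace Ω] [MeasurableSpace Ω'] {P : Measure Ω}
  {P' : Measure Ω'}

/-- Random vectors in `[-∞, ∞]` with the same distribution functions have the same law. -/
theorem identDistrib_of_measure_forall_le {ι : Type*} [Finite ι] [IsProbabilityMeasure P]
    [IsProbabilityMeasure P'] {F : Ω → ι → EReal} {G : Ω' → ι → EReal} (hF : AEMeasurable F P)
    (hG : AEMeasurable G P')
    (h : ∀ a : ι → EReal, P {ω | ∀ i, F ω i ≤ a i} = P' {ω | ∀ i, G ω i ≤ a i}) :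
    IdentDistrib F G P P' := by
  refine ⟨hF, hG, ?_⟩
  have := Measure.isProbabilityMeasure_map (μ := P) hF
  have := Measure.isProbabilityMeasure_map (μ := P') hG
  have hgen : (MeasurableSpace.pi : MeasurableSpace (ι → EReal)) =
      MeasurableSpace.generateFrom
        (Set.univ.pi '' Set.univ.pi fun _ : ι => Set.range (Set.Iic : EReal → Set EReal)) := by
    refine (generateFrom_eq_pi (fun _ => ?_) fun _ => ?_).symm
    · exact (BorelSpace.measurable_eq.trans (borel_eq_generateFrom_Iic EReal)).symm
    · exact ⟨fun _ => Set.Iic ⊤, fun _ => ⟨⊤, rfl⟩, by simp [Set.iUnion_const]⟩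
  refine ext_of_generate_finite _ hgen ?_ ?_ (by simp)
  · refine IsPiSystem.pi fun _ => ?_
    rintro _ ⟨a, rfl⟩ _ ⟨b, rfl⟩ -
    exact ⟨a ⊓ b, Set.Iic_inter_Iic.symm⟩
  · rintro _ ⟨s, hs, rfl⟩
    choose a ha using fun i => hs i (Set.mem_univ i)
    have hs' : s = fun i => Set.Iic (a i) := funext fun i => (ha i).symm
    have hm : MeasurableSet (Set.univ.pi s) :=
      MeasurableSet.univ_pi fun i => ha i ▸ measurableSet_Iic
    rw [Measure.map_apply_of_aemeasurable hF hm, Measure.map_apply_of_aemeasurable hG hm, hs']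
    have h1 := h a
    simpa only [Set.preimage, Set.mem_univ_pi, Set.mem_Iic] using h1

/-- Distribution functions on `[-∞, ∞]` reduce to positive finite thresholds: a threshold at most
`0` gives probability zero on both sides, and a threshold `⊤` imposes nothing. -/
theorem sameLaw_of_forall_pos [IsProbabilityMeasure P] [IsProbabilityMeasure P']
    {X : T → Ω → ℝ} {Y : T → Ω' → ℝ≥0∞} (hX : ∀ t, AEMeasurable (X t) P)
    (hY : ∀ t, AEMeasurable (Y t) P') (hX0 : ∀ t, P {ω | X t ω ≤ 0} = 0)
    (hY0 : ∀ t, P' {ω | Y t ω ≤ 0} = 0)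
    (h : ∀ M : Finset T, M.Nonempty → ∀ x : T → ℝ, (∀ t, 0 < x t) →
      P {ω | ∀ t ∈ M, X t ω ≤ x t} = P' {ω | ∀ t ∈ M, Y t ω ≤ ENNReal.ofReal (x t)}) :
    SameLaw (fun t ω => ((X t ω : ℝ) : EReal)) P (fun t ω => ((Y t ω : ℝ≥0∞) : EReal)) P' := by
  classical
  intro M
  refine identDistrib_of_measure_forall_le
    (aemeasurable_pi_lambda _ fun t => (hX t).coe_real_ereal)
    (aemeasurable_pi_lambda _ fun t => measurable_coe_ennreal_ereal.comp_aemeasurable (hY t))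
    fun a => ?_
  by_cases ha : ∃ t, a t ≤ 0
  · obtain ⟨t, ht⟩ := ha
    rw [measure_mono_null _ (hX0 t), measure_mono_null _ (hY0 t)]
    · exact fun ω hω => EReal.coe_ennreal_le_coe_ennreal_iff.1 ((hω t).trans ht)
    · exact fun ω hω => EReal.coe_le_coe_iff.1 ((hω t).trans ht)
  push Not at ha
  let b : T → EReal := fun t => if ht : t ∈ M then a ⟨t, ht⟩ else ⊤
  have hb : ∀ t : M, b t = a t := fun t => by simp [b]
  have hb0 : ∀ t, 0 < b t := fun t => by
    by_cases ht : t ∈ M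
    · exact (ha ⟨t, ht⟩).trans_eq (hb ⟨t, ht⟩).symm
    · simp [b, ht]
  -- The value `1` is an arbitrary positive filler; indices with `b t = ⊤` are dropped from `N`.
  let x : T → ℝ := fun t => if b t = ⊤ then 1 else (b t).toReal
  have hx : ∀ t, 0 < x t := fun t => by
    by_cases ht : b t = ⊤
    · simp [x, ht]
    · simpa [x, ht] using EReal.toReal_pos (hb0 t) ht
  have hxb : ∀ t, b t ≠ ⊤ → ((x t : ℝ) : EReal) = b t := fun t ht => by
    simp only [x, ht, if_false]
    exact EReal.coe_toReal ht (ne_bot_of_gt (hb0 t))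
  let N : Finset T := M.filter fun t => b t ≠ ⊤
  have hN : ∀ f : T → EReal, (∀ t : M, f t ≤ a t) ↔ ∀ t ∈ N, f t ≤ (x t : ℝ) := by
    intro f
    simp only [N, Finset.mem_filter]
    constructor
    · rintro hf t ⟨ht, htop⟩
      rw [hxb t htop, hb ⟨t, ht⟩]
      exact hf ⟨t, ht⟩
    · intro hf t
      by_cases htop : b t = ⊤
      · rw [← hb, htop]; exact le_top
      · rw [← hb, ← hxb t htop]
        exact hf t ⟨t.2, htop⟩
  have hYx : ∀ t ω, ((Y t ω : ℝ≥0∞) : EReal) ≤ (x t : ℝ) ↔ Y t ω ≤ ENNReal.ofReal (x t) := by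
    intro t ω
    rw [← EReal.coe_ennreal_le_coe_ennreal_iff, EReal.coe_ennreal_ofReal, max_eq_left (hx t).le]
  have hXN : {ω | ∀ t : M, ((X t ω : ℝ) : EReal) ≤ a t} = {ω | ∀ t ∈ N, X t ω ≤ x t} := by
    ext ω
    rw [Set.mem_ofPred_eq, Set.mem_ofPred_eq]
    simpa only [EReal.coe_le_coe_iff] using hN fun t => ((X t ω : ℝ) : EReal)
  have hYN : {ω | ∀ t : M, ((Y t ω : ℝ≥0∞) : EReal) ≤ a t} =
      {ω | ∀ t ∈ N, Y t ω ≤ ENNReal.ofReal (x t)} := by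
    ext ω
    rw [Set.mem_ofPred_eq, Set.mem_ofPred_eq]
    simpa only [hYx] using hN fun t => ((Y t ω : ℝ≥0∞) : EReal)
  rw [hXN, hYN]
  rcases N.eq_empty_or_nonempty with h0 | h1
  · simp [h0]
  · exact h N h1 x hx

/-- Let `x` decrease to `0`. Applied to Fréchet margins, it shows that both processes are almost
surely positive. -/
theorem measure_eq_zero_of_forall_le_exp {s : Set Ω}
    (h : ∀ x : ℝ, 0 < x → P s ≤ ENNReal.ofReal (Real.exp (-(1 / x)))) : P s = 0 := by
  have hlim : Tendsto (fun y : ℝ => ENNReal.ofReal (Real.exp (-y))) atTop (𝓝 0) := by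
    simpa using ENNReal.tendsto_ofReal Real.tendsto_exp_neg_atTop_nhds_zero
  refine le_antisymm (ge_of_tendsto hlim ?_) bot_le
  filter_upwards [eventually_gt_atTop 0] with y hy
  simpa using h (1 / y) (one_div_pos.2 hy)

end SameLaw

/-! ### The spectral representation -/

section Spectral

variable {T : Type*} {θ : Finset T → ℝ}

open Classical in
theorem sum_tauCoeff_singleton (h0 : θ ∅ = 0) (t : T) (h1 : θ {t} = 1) (x : T → ℝ) :
    ∑ L ∈ ({t} : Finset T).powerset with L.Nonempty, tauCoeff θ {t} L * ⨆ s : L, 1 / x s =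
      1 / x t := by
  have hL : (({t} : Finset T).powerset.filter fun L => L.Nonempty) = {{t}} := by
    ext L
    simp only [Finset.mem_filter, Finset.mem_powerset, Finset.mem_singleton,
      Finset.subset_singleton_iff]
    constructor
    · rintro ⟨rfl | rfl, h⟩
      · exact absurd h (by simp)
      · rfl
    · rintro rfl
      exact ⟨Or.inr rfl, Finset.singleton_nonempty t⟩
  have hτ : tauCoeff θ {t} {t} = 1 := by
    rw [tauCoeff, ← insert_empty_eq t, Finset.sum_powerset_insert (Finset.notMem_empty t)]
    simp [h0, h1]
  have hs : ∀ s : ({t} : Finset T), 1 / x s = 1 / x t := fun s => by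
    rw [Finset.mem_singleton.1 s.2]
  have : Nonempty ({t} : Finset T) := ⟨⟨t, Finset.mem_singleton_self t⟩⟩
  rw [hL, Finset.sum_singleton, hτ, one_mul, iSup_congr hs, ciSup_const]

theorem measurable_memIndicator (t : T) : Measurable (memIndicator t) :=
  Measurable.ite (PowerSpace.isClopen_mem t).isOpen.measurableSet measurable_const
    measurable_const

variable {μ : Measure (PowerSpace.Nonempty T)}

theorem IsIntegralRepresentation.lintegral_memIndicator (h : IsIntegralRepresentation θ μ)
    (t : T) : ∫⁻ Q, memIndicator t Q ∂(μ.map (Subtype.val : PowerSpace.Nonempty T → _)) =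
      ENNReal.ofReal (θ {t}) := by
  have h1 : ∀ Q : PowerSpace T, (memIndicator t Q : ℝ≥0∞) =
      {Q : PowerSpace T | t ∈ Q}.indicator 1 Q := fun Q => by
    by_cases hQ : t ∈ Q <;> simp [memIndicator, hQ]
  have hm := (PowerSpace.isClopen_mem t).isOpen.measurableSet
  simp_rw [h1]
  rw [lintegral_indicator_one hm, Measure.map_apply measurable_subtype_coe hm,
    h.measure_hit, ENNReal.ofReal_toReal (h.measure_hit_ne_top _)]
  simp

open Classical in
theorem IsIntegralRepresentation.sum_tauCoeff_nonneg (h : IsIntegralRepresentation θ μ)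
    (M : Finset T) {x : T → ℝ} (hx : ∀ t, 0 < x t) :
    0 ≤ ∑ L ∈ M.powerset with L.Nonempty, tauCoeff θ M L * ⨆ t : L, 1 / x t := by
  refine Finset.sum_nonneg fun L hL => ?_
  obtain ⟨hLM, hne⟩ := Finset.mem_filter.1 hL
  rw [h.tauCoeff_eq hne (Finset.mem_powerset.1 hLM)]
  exact mul_nonneg measureReal_nonneg (Real.iSup_nonneg fun t => (one_div_pos.2 (hx t)).le)

variable {Ω : Type*} [MeasurableSpace Ω] {P : Measure Ω} {Pi : Ω → Set (ℝ≥0 × PowerSpace T)}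

open Classical in
theorem IsIntegralRepresentation.measure_poissonMax_le (h : IsIntegralRepresentation θ μ)
    (hPi : IsPoissonPointProcess Pi P
      (spectralIntensity (μ.map (Subtype.val : PowerSpace.Nonempty T → _))))
    (M : Finset T) {x : T → ℝ} (hx : ∀ t, 0 < x t) :
    P {ω | ∀ t ∈ M, poissonMax memIndicator Pi t ω ≤ ENNReal.ofReal (x t)} =
      ENNReal.ofReal (Real.exp
        (-∑ L ∈ M.powerset with L.Nonempty, tauCoeff θ M L * ⨆ t : L, 1 / x t)) := by
  simp_rw [← inter_exceedSet_eq_empty_iff (Pi := Pi) (M := M) fun t => (hx t).le]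
  exact hPi.measure_inter_eq_empty (measurableSet_exceedSet M x) (h.sum_tauCoeff_nonneg M hx)
    (h.spectralIntensity_exceedSet M hx)

/-- Counts of the point process are only almost everywhere measurable, so sublevel events are
handled as null-measurable void events. -/
theorem IsPoissonPointProcess.aemeasurable_poissonMax {m : Measure (ℝ≥0 × PowerSpace T)}
    (hPi : IsPoissonPointProcess Pi P m) (t : T) :
    AEMeasurable (poissonMax memIndicator Pi t) P := by
  refine NullMeasurable.aemeasurable ?_
  refine measurable_of_Iic (α := ℝ≥0∞) (δ := NullMeasurableSpace Ω P) fun c => ?_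
  change NullMeasurableSet {ω | poissonMax memIndicator Pi t ω ≤ c} P
  by_cases hc : c = ⊤
  · simp [hc]
  · have h1 : {ω | poissonMax memIndicator Pi t ω ≤ c} =
        {ω | Pi ω ∩ exceedSet {t} (fun _ => c.toReal) = ∅} := by
      ext ω
      rw [Set.mem_ofPred_eq, Set.mem_ofPred_eq,
        inter_exceedSet_eq_empty_iff fun _ => ENNReal.toReal_nonneg]
      simp [ENNReal.ofReal_toReal hc]
    rw [h1]
    exact hPi.nullMeasurableSet (measurableSet_exceedSet _ _)

/-- The Tawn–Molchanov process has the law of the Poisson process maxima belonging to the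
integral representation of its extremal coefficient function. -/
theorem IsIntegralRepresentation.sameLaw (h : IsIntegralRepresentation θ μ) (h0 : θ ∅ = 0)
    (h1 : ∀ t, θ {t} = 1) {Ω' : Type*} [MeasurableSpace Ω'] {P' : Measure Ω'}
    [IsProbabilityMeasure P'] {X : T → Ω' → ℝ} (hX : IsTMProcess θ X P') [IsProbabilityMeasure P]
    (hPi : IsPoissonPointProcess Pi P
      (spectralIntensity (μ.map (Subtype.val : PowerSpace.Nonempty T → _)))) :
    SameLaw (fun t ω => ((X t ω : ℝ) : EReal)) P'
      (fun t ω => ((poissonMax memIndicator Pi t ω : ℝ≥0∞) : EReal)) P := by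
  classical
  refine sameLaw_of_forall_pos (fun t => (hX.measurable t).aemeasurable)
    hPi.aemeasurable_poissonMax (fun t => ?_) (fun t => ?_) fun M hM x hx => ?_
  · refine measure_eq_zero_of_forall_le_exp fun x hx => ?_
    have h2 := hX.fdd {t} (Finset.singleton_nonempty t) (fun _ => x) fun _ => hx
    rw [sum_tauCoeff_singleton h0 t (h1 t) fun _ => x] at h2
    rw [← h2]
    refine measure_mono fun ω hω => ?_
    simpa using le_trans hω hx.le
  · refine measure_eq_zero_of_forall_le_exp fun x hx => ?_
    have h2 := h.measure_poissonMax_le hPi {t} (x := fun _ => x) fun _ => hx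
    rw [sum_tauCoeff_singleton h0 t (h1 t) fun _ => x] at h2
    rw [← h2]
    refine measure_mono fun ω hω => ?_
    simpa using le_trans hω bot_le
  · rw [hX.fdd M hM x hx, h.measure_poissonMax_le hPi M hx]

end Spectral

end

/-! ### The main theorem. -/

theorem theorem2 {T : Type u} (θ : Finset T → ℝ) (hθ : θ ∈ ecfSet.{w} T) :
    ∃ μ : Measure (PowerSpace.Nonempty T),
      (IsIntegralRepresentation θ μ ∧ ∀ μ', IsIntegralRepresentation θ μ' → μ' = μ) ∧
      ∀ (Ω : Type v) [MeasurableSpace Ω] (P : Measure Ω) [IsProbabilityMeasure P]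
        (X : T → Ω → ℝ), IsTMProcess θ X P →
          IsSpectralRepresentation.{u, u, v, z} X P
            (μ.map (Subtype.val : PowerSpace.Nonempty T → PowerSpace T)) memIndicator := by
  obtain ⟨Ω₀, _, P₀, _, X₀, hX₀, hECF⟩ := hθ
  obtain ⟨μ, hμ⟩ := hECF.exists_isIntegralRepresentation hX₀
  have h1 : ∀ t, θ {t} = 1 := fun t => hECF.singleton hX₀ t
  refine ⟨μ, ⟨hμ, fun μ' hμ' => hμ'.unique hμ⟩, fun Ω _ P _ X hX => ?_⟩
  exact
    { measurable := measurable_memIndicator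
      lintegral_eq_one := fun t => by rw [hμ.lintegral_memIndicator, h1, ENNReal.ofReal_one]
      exists_poisson := by
        have := hμ.finite_on_compacts
        have := hμ.inner_regular
        exact exists_isPoissonPointProcess_spectralIntensity μ
      sameLaw := fun Ω' _ P' _ Pi hPi => hμ.sameLaw hECF.1 h1 hX hPi }
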